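/- Let $m\ge 1$ and let $U\subset\mathbb R^m$ be bounded and open. Let $T:L^2(U)\to L^2(U)$, $(Th)(x)=\int_U F(x,y)h(y)\,dy$, be a positive semi-definite integral operator with a complex-valued Hermitian kernel $F$ (that is, $F(x,y)=\overline{F(y,x)}$), let $k\ge1$ be an integer, and let $\lambda_1(T)\ge\lambda_2(T)\ge\dots\ge0$ be the eigenvalues of $T$ in decreasing order, repeated according to multiplicity (a finite list of positive eigenvalues being continued by zeros). Define \[ M_j=\frac1{j!}\sup_{x,y\in U}\ \sup_{v\in\mathbb R^m,\,|v|=1}\left|\frac{\partial^j}{\partial s^j}\Big|_{s=0}F(x,y+sv)\right|,\qquad 1\le j\le k, \] and, for $a>0$ and $n\ge 1$, $J_{k,n}=\{j\in\mathbb N\mid 1\le j\le k,\ a(j+m)\le\sqrt[m]{n/2}\}$. For constants $A,a>0$ consider the estimate \[ \lambda_n(T)\le A\min_{j\in J_{k,n}}\left[M_j\left(a\sqrt[m]{\tfrac2n}\right)^j(j+m)^{j+m}\right]\quad\text{for all } n\ge1 \qquad(*) \] (nothing is claimed for those $n$ with $J_{k,n}=\emptyset$). (a) Suppose that $F$ is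 of class $C^k$ on an open neighbourhood of $\bar U\times\bar U$. If $U$ has only finitely many connected components, or if $M_j>0$ for all $1\le j\le k$, then there are constants $A,a>0$ such that $(*)$ holds. Moreover, without this additional condition, there is a constant $C>0$ with $\lambda_n(T)\le C\,n^{-k/m}$ for all $n\ge1$. (b) Suppose that $U$ is locally quasiconvex: there are $r>0$ and $c$ such that any $x,y\in U$ with $|x-y|<r$ can be joined inside $U$ by a polygonal path of length at most $c|x-y|$ (convex sets and bounded Lipschitz domains have this property). Then there are constants $A,a>0$ depending only on $U$ such that $(*)$ holds for all $k\ge1$ and all such $T$ with a kernel $F\in C^k(\bar U\times\bar U)$ in the sense that $F$ is $C^k$ on $U\times U$ and all its derivatives of order at most $k$ extend continuously to $\bar U\times\bar U$. Moreover, for each such $k$ and $T$ there is a constant $C>0$ with $\lambda_n(T)\le C\,n^{-k/m}$ for all $n\ge1$. -/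

import Mathlib

open MeasureTheory Set

noncomputable section

/-- The Hilbert space `L²(U)` of complex-valued functions on a set `U ⊆ ℝᵐ`. -/
abbrev L2 {m : ℕ} (U : Set (EuclideanSpace ℝ (Fin m))) : Type :=
  Lp ℂ 2 ((volume : Measure (EuclideanSpace ℝ (Fin m))).restrict U)

/-- The kernel is Hermitian: `F(x,y)` is the conjugate of `F(y,x)`. -/
def IsHermitianKernel {m : ℕ} (U : Set (EuclideanSpace ℝ (Fin m)))
    (F : EuclideanSpace ℝ (Fin m) → EuclideanSpace ℝ (Fin m) → ℂ) : Prop :=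
  ∀ x ∈ U, ∀ y ∈ U, F x y = starRingEnd ℂ (F y x)

/-- `T` is the integral operator on `L²(U)` with kernel `F`:
`(T h)(x) = ∫_U F(x,y) h(y) dy` for almost every `x ∈ U`. -/
def IsIntegralOperator {m : ℕ} (U : Set (EuclideanSpace ℝ (Fin m)))
    (F : EuclideanSpace ℝ (Fin m) → EuclideanSpace ℝ (Fin m) → ℂ)
    (T : L2 U →L[ℂ] L2 U) : Prop :=
  ∀ h : L2 U, ∀ᵐ x ∂((volume : Measure (EuclideanSpace ℝ (Fin m))).restrict U),
    T h x = ∫ y in U, F x y * h y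

/-- The number of eigenvalues `≥ t` of `T`, counted with multiplicity: the dimension of the sum of
all eigenspaces of `T` for real eigenvalues `s ≥ t`. -/
def eigenvalueCount {H : Type*} [NormedAddCommGroup H] [InnerProductSpace ℂ H]
    (T : H →L[ℂ] H) (t : ℝ) : Cardinal :=
  Module.rank ℂ
    ((⨆ s ∈ Set.Ici t, Module.End.eigenspace (T : H →ₗ[ℂ] H) ((s : ℝ) : ℂ)) : Submodule ℂ H)

/-- The `n`-th eigenvalue `λ_n(T)` (`n = 1, 2, …`) of a compact positive semi-definite operator:
its positive eigenvalues are listed in decreasing order and repeated according to multiplicity,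
and the list is continued by zeros if it is finite. So `λ_n(T)` is the largest `t > 0` such that at
least `n` eigenvalues (with multiplicity) are `≥ t`, and `0` if there is no such `t`. -/
def nthEigenvalue {H : Type*} [NormedAddCommGroup H] [InnerProductSpace ℂ H]
    (T : H →L[ℂ] H) (n : ℕ) : ℝ :=
  sSup ({0} ∪ {t : ℝ | 0 < t ∧ (n : Cardinal) ≤ eigenvalueCount T t})

/-- `M_j = (1/j!) sup_{x,y ∈ U} sup_{|v| = 1} |∂ʲ/∂sʲ|_{s=0} F(x, y + s v)|`. -/
def kernelDerivSup {m : ℕ} (U : Set (EuclideanSpace ℝ (Fin m)))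
    (F : EuclideanSpace ℝ (Fin m) → EuclideanSpace ℝ (Fin m) → ℂ) (j : ℕ) : ℝ :=
  (1 / (j.factorial : ℝ)) *
    sSup {r : ℝ | ∃ x ∈ U, ∃ y ∈ U,
      ∃ v ∈ Metric.sphere (0 : EuclideanSpace ℝ (Fin m)) 1,
        r = ‖iteratedDeriv j (fun s : ℝ => F x (y + s • v)) 0‖}

/-- The index set `J_{k,n} = {j ∈ ℕ | j ≥ 1, j ≤ k, a (j + m) ≤ (n/2)^{1/m}}`. -/
def admissibleOrders (m : ℕ) (a : ℝ) (k n : ℕ) : Set ℕ :=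
  {j : ℕ | 1 ≤ j ∧ j ≤ k ∧ a * ((j : ℝ) + m) ≤ ((n : ℝ) / 2) ^ ((1 : ℝ) / m)}

/-- `F` is of class `C^k` on the closed set `Ū × Ū`, in the sense that it is `C^k` on an open
neighbourhood of it. -/
def IsCkNearClosure {m : ℕ} (k : ℕ) (U : Set (EuclideanSpace ℝ (Fin m)))
    (F : EuclideanSpace ℝ (Fin m) → EuclideanSpace ℝ (Fin m) → ℂ) : Prop :=
  ∃ W : Set (EuclideanSpace ℝ (Fin m) × EuclideanSpace ℝ (Fin m)),
    IsOpen W ∧ closure U ×ˢ closure U ⊆ W ∧ ContDiffOn ℝ k (Function.uncurry F) W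

/-- `F ∈ C^k(Ū × Ū)` in the intrinsic sense: `F` is `C^k` on `U × U` (for `U` open), and all its
derivatives of order at most `k` extend continuously to `Ū × Ū`. -/
def IsCkUpToClosure {m : ℕ} (k : ℕ) (U : Set (EuclideanSpace ℝ (Fin m)))
    (F : EuclideanSpace ℝ (Fin m) → EuclideanSpace ℝ (Fin m) → ℂ) : Prop :=
  ContDiffOn ℝ k (Function.uncurry F) (U ×ˢ U) ∧
  ∀ i : ℕ, i ≤ k →
    ∃ G : EuclideanSpace ℝ (Fin m) × EuclideanSpace ℝ (Fin m) →
        ContinuousMultilinearMap ℝ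
          (fun _ : Fin i => EuclideanSpace ℝ (Fin m) × EuclideanSpace ℝ (Fin m)) ℂ,
      ContinuousOn G (closure U ×ˢ closure U) ∧
      EqOn (iteratedFDeriv ℝ i (Function.uncurry F)) G (U ×ˢ U)

/-- Points of `U` that are close to each other can be joined inside `U` by a polygonal path whose
length is at most a fixed multiple of their distance. Convex sets and bounded Lipschitz domains
have this property. -/
def IsLocallyQuasiconvex {m : ℕ} (U : Set (EuclideanSpace ℝ (Fin m))) : Prop :=
  ∃ r : ℝ, 0 < r ∧ ∃ C : ℝ, ∀ x ∈ U, ∀ y ∈ U, dist x y < r →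
    ∃ (N : ℕ) (p : ℕ → EuclideanSpace ℝ (Fin m)), p 0 = x ∧ p N = y ∧
      (∀ i < N, segment ℝ (p i) (p (i + 1)) ⊆ U) ∧
      ∑ i ∈ Finset.range N, dist (p i) (p (i + 1)) ≤ C * dist x y

/-- The eigenvalue estimate
`λ_n(T) ≤ A · min_{j ∈ J_{k,n}} [ M_j (a (2/n)^{1/m})ʲ (j + m)^{j + m} ]` for all `n ≥ 1`.
The minimum over the empty set is `+∞`: nothing is claimed for `n` with `J_{k,n} = ∅`. -/
def EigenvalueBound {m : ℕ} (U : Set (EuclideanSpace ℝ (Fin m)))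
    (F : EuclideanSpace ℝ (Fin m) → EuclideanSpace ℝ (Fin m) → ℂ)
    (T : L2 U →L[ℂ] L2 U) (k : ℕ) (A a : ℝ) : Prop :=
  ∀ n : ℕ, 1 ≤ n → ∀ j ∈ admissibleOrders m a k n,
    nthEigenvalue T n ≤
      A * (kernelDerivSup U F j * (a * (2 / (n : ℝ)) ^ ((1 : ℝ) / m)) ^ j *
        ((j : ℝ) + m) ^ (j + m))

/-- `λ_n(T) = O(n^{-k/m})`. -/
def EigenvaluePowerDecay {m : ℕ} (U : Set (EuclideanSpace ℝ (Fin m)))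
    (T : L2 U →L[ℂ] L2 U) (k : ℕ) : Prop :=
  ∃ C : ℝ, 0 < C ∧ ∀ n : ℕ, 1 ≤ n →
    nthEigenvalue T n ≤ C * (n : ℝ) ^ (-((k : ℝ) / m))

end

/-! If fewer than `n` linear functionals are given and `‖T x‖ ≤ B ‖x‖` wherever they all vanish,
then `λ_n(T) ≤ B` (`nthEigenvalue_le_of_functionals`). For an integral operator, such functionals
come from approximating `F(x,·)` uniformly by combinations of fixed functions of `y`
(`nthEigenvalue_le_of_kernel_approx`). Here `U` is cut into at most `q^m` cells, and on each cell
`F(x,·)` is replaced by its Taylor polynomial of degree less than `j` at a base point. This takes at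
most `(q j)^m` functions, and the choice of `q` as the integer part of `(n/2)^{1/m}/(j+m)` keeps
their number at most `n/2`. The Taylor error is governed by the length of a polygonal path from the
base point (`norm_sub_taylorPoly_le`), hence by the cell diameter when short paths exist.

In the quasiconvex case the paths stay in `U`, and polarization bounds the full `j`-th derivative by
`j^j M_j` (`norm_iteratedFDeriv_le_kernelDerivSup`). Since `j^j/j! ≤ e^j`, all constants depend on
`U` only. For a general `U` the paths are segments in a neighbourhood of its closure. The derivative
bound `B_j` there need not be controlled by `M_j`, so `A` absorbs the finitely many ratios `B_j/M_j`
with `M_j > 0`. If `M_j = 0` and `U` has finitely many components, then `F(x,·)` is a polynomial on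
each component, and `λ_n(T)` vanishes for the admissible `n`. -/

/-! ### Eigenvalue bounds from linear functionals -/

/-- Eigenspaces of a symmetric operator are orthogonal, so Pythagoras applies to both `x` and `T x`.
-/
theorem LinearMap.IsSymmetric.mul_norm_le_of_mem_iSup_eigenspace {H : Type*} [NormedAddCommGroup H]
    [InnerProductSpace ℂ H] {T : H →ₗ[ℂ] H} (hT : T.IsSymmetric) {t : ℝ} (ht : 0 ≤ t) {x : H}
    (hx : x ∈ (⨆ s ∈ Set.Ici t, Module.End.eigenspace T ((s : ℝ) : ℂ))) :
    t * ‖x‖ ≤ ‖T x‖ := by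
  classical
  rw [iSup_subtype', Submodule.mem_iSup_iff_exists_dfinsupp'] at hx
  obtain ⟨f, rfl⟩ := hx
  have hinj : Function.Injective (fun s : Set.Ici t => ((s : ℝ) : ℂ)) := fun a b h =>
    Subtype.ext (Complex.ofReal_injective h)
  have hV := hT.orthogonalFamily_eigenspaces.comp hinj
  have h1 := hV.norm_sum (fun s => f s) f.support
  have h2 := hV.norm_sum (fun s => ((s : ℝ) : ℂ) • f s) f.support
  have hTx : T (f.sum fun _ y => (y : H)) = ∑ s ∈ f.support, (((s : ℝ) : ℂ) • f s : H) := by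
    rw [DFinsupp.sum, map_sum]
    exact Finset.sum_congr rfl fun s _ => Module.End.mem_eigenspace_iff.1 (f s).2
  rw [hTx, DFinsupp.sum]
  refine (sq_le_sq₀ (by positivity) (norm_nonneg _)).1 ?_
  simp only [Submodule.coe_subtypeₗᵢ, Submodule.subtype_apply, Submodule.coe_smul] at h1 h2
  rw [mul_pow, h1, h2, Finset.mul_sum]
  refine Finset.sum_le_sum fun s _ => ?_
  rw [norm_smul, mul_pow, Complex.norm_real, Real.norm_of_nonneg (ht.trans s.2)]
  gcongr
  exact s.2

theorem nthEigenvalue_le_of_functionals {H : Type} [NormedAddCommGroup H]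
    [InnerProductSpace ℂ H] {T : H →L[ℂ] H} (hT : (T : H →ₗ[ℂ] H).IsSymmetric)
    {J : Type} [Fintype J] (l : J → H →ₗ[ℂ] ℂ) {n : ℕ} (hn : Fintype.card J < n) {B : ℝ}
    (hB : 0 ≤ B) (h : ∀ x, (∀ i, l i x = 0) → ‖T x‖ ≤ B * ‖x‖) : nthEigenvalue T n ≤ B := by
  refine csSup_le ⟨0, Or.inl rfl⟩ ?_
  rintro t (rfl | ⟨ht, hc⟩)
  · exact hB
  set V : Submodule ℂ H := ⨆ s ∈ Set.Ici t, Module.End.eigenspace (T : H →ₗ[ℂ] H) ((s : ℝ) : ℂ)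
    with hV
  -- Dimension count: `V` has rank at least `n`, more than the number of functionals, so they have a
  -- common nonzero zero in `V`.
  have hnot : ¬ Function.Injective ((LinearMap.pi l).comp V.subtype) := by
    intro hi
    have h1 := LinearMap.rank_le_of_injective _ hi
    rw [rank_fun'] at h1
    have h2 : (n : Cardinal) ≤ (Fintype.card J : Cardinal) := hc.trans h1
    exact absurd (Nat.cast_le.1 h2) (by omega)
  rw [injective_iff_map_eq_zero] at hnot
  push Not at hnot
  obtain ⟨x, hx, hx0⟩ := hnot
  have hx' : ∀ i, l i x = 0 := fun i => congrFun hx i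
  have h1 := hT.mul_norm_le_of_mem_iSup_eigenspace ht.le x.2
  have h2 := h _ hx'
  have h3 : 0 < ‖(x : H)‖ := norm_pos_iff.2 (by simpa using hx0)
  exact le_of_mul_le_mul_right (h1.trans h2) h3

theorem nthEigenvalue_le_norm {H : Type} [NormedAddCommGroup H]
    [InnerProductSpace ℂ H] {T : H →L[ℂ] H} (hT : (T : H →ₗ[ℂ] H).IsSymmetric) {n : ℕ}
    (hn : 1 ≤ n) : nthEigenvalue T n ≤ ‖T‖ :=
  nthEigenvalue_le_of_functionals hT (J := Empty) (fun i => i.elim) (by simpa [Nat.pos_iff_ne_zero, Nat.one_le_iff_ne_zero] using hn)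
    (norm_nonneg _) fun x _ => T.le_opNorm x

/-- Passing from `L²` to `L¹` and from a uniform bound back to `L²` each costs a factor
`vol(U)^{1/2}`. -/
theorem norm_integralOperator_le {m : ℕ} {U : Set (EuclideanSpace ℝ (Fin m))}
    (hUb : Bornology.IsBounded U) {h g : L2 U} {E : ℝ} (hE : 0 ≤ E)
    (hg : ∀ᵐ x ∂((volume : Measure (EuclideanSpace ℝ (Fin m))).restrict U),
      ‖g x‖ ≤ E * ∫ y in U, ‖h y‖) : ‖g‖ ≤ E * volume.real U * ‖h‖ := by
  have hfin : volume U ≠ ⊤ := hUb.measure_lt_top.ne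
  have : IsFiniteMeasure ((volume : Measure (EuclideanSpace ℝ (Fin m))).restrict U) :=
    ⟨by simpa using hUb.measure_lt_top⟩
  have hI : ∫ y in U, ‖h y‖ ≤ ‖h‖ * (volume.real U) ^ (1 / 2 : ℝ) := by
    have h1 := eLpNorm_le_eLpNorm_mul_rpow_measure_univ (p := 1) (q := 2) (by norm_num)
      (Lp.aestronglyMeasurable h)
    have h2 : ∫ y in U, ‖h y‖ = (eLpNorm h 1 (volume.restrict U)).toReal := by
      rw [eLpNorm_one_eq_lintegral_enorm, integral_norm_eq_lintegral_enorm
        (Lp.aestronglyMeasurable h)]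
    rw [h2, Lp.norm_def]
    refine (ENNReal.toReal_mono ?_ h1).trans ?_
    · refine ENNReal.mul_ne_top (Lp.eLpNorm_ne_top h) (ENNReal.rpow_ne_top_of_nonneg ?_ ?_)
      · norm_num
      · simpa using hfin
    · rw [ENNReal.toReal_mul, ← ENNReal.toReal_rpow]
      norm_num [Measure.real]
  have h1 := Lp.norm_le_of_ae_bound (mul_nonneg hE (integral_nonneg fun _ => norm_nonneg _)) hg
  have hs : (volume.real U) ^ (1 / 2 : ℝ) * (volume.real U) ^ (1 / 2 : ℝ) = volume.real U := by
    rw [← Real.sqrt_eq_rpow, Real.mul_self_sqrt measureReal_nonneg]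
  have hr : (measureUnivNNReal ((volume : Measure (EuclideanSpace ℝ (Fin m))).restrict U) : ℝ) ^
      (2 : ENNReal).toReal⁻¹ = (volume.real U) ^ (1 / 2 : ℝ) := by
    have h0 : (measureUnivNNReal ((volume : Measure (EuclideanSpace ℝ (Fin m))).restrict U) : ℝ) =
        volume.real U := by
      rw [measureUnivNNReal, ENNReal.coe_toNNReal_eq_toReal, Measure.restrict_apply_univ,
        Measure.real]
    rw [h0]
    norm_num
  rw [hr] at h1
  calc ‖g‖ ≤ (volume.real U) ^ (1 / 2 : ℝ) * (E * ∫ y in U, ‖h y‖) := h1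
    _ ≤ (volume.real U) ^ (1 / 2 : ℝ) * (E * (‖h‖ * (volume.real U) ^ (1 / 2 : ℝ))) := by gcongr
    _ = E * ((volume.real U) ^ (1 / 2 : ℝ) * (volume.real U) ^ (1 / 2 : ℝ)) * ‖h‖ := by ring
    _ = _ := by rw [hs]

/-! ### Symmetry of higher derivatives and polarization -/

section Symmetry

variable {E F : Type} [NormedAddCommGroup E] [NormedSpace ℝ E] [NormedAddCommGroup F]
  [NormedSpace ℝ F]

/-- Swapping the first two slots is the symmetry of the second derivative of `iteratedFDeriv ℝ n f`.
A later swap follows by differentiating the identity of one order less, which holds near `x`. -/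
theorem iteratedFDeriv_comp_adjacent_swap {n : ℕ} (i : Fin n) :
    ∀ {f : E → F} {x : E}, ContDiffAt ℝ (n + 1 : ℕ) f x → ∀ v : Fin (n + 1) → E,
    iteratedFDeriv ℝ (n + 1) f x (v ∘ Equiv.swap i.castSucc i.succ) =
      iteratedFDeriv ℝ (n + 1) f x v := by
  induction n with
  | zero => exact i.elim0
  | succ n ih =>
    intro f x hf v
    refine Fin.cases ?_ (fun i => ?_) i
    · have hg : ContDiffAt ℝ 2 (iteratedFDeriv ℝ n f) x :=
        hf.iteratedFDeriv_right (by norm_cast; omega)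
      have hs := hg.isSymmSndFDerivAt (by simp)
      have key : ∀ w : Fin (n + 1 + 1) → E, iteratedFDeriv ℝ (n + 1 + 1) f x w =
          fderiv ℝ (fderiv ℝ (iteratedFDeriv ℝ n f)) x (w 0) (w 1) (Fin.tail (Fin.tail w)) := by
        intro w
        have hd : DifferentiableAt ℝ (iteratedFDeriv ℝ (n + 1) f) x :=
          hf.differentiableAt_iteratedFDeriv (by norm_cast; omega)
        have hd' : DifferentiableAt ℝ (fderiv ℝ (iteratedFDeriv ℝ n f)) x :=
          (hg.fderiv_right (m := 1) (by norm_num)).differentiableAt (by norm_num)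
        have h1 := (hd.hasFDerivAt.continuousMultilinear_apply_const (Fin.tail w)).fderiv
        have h2 := ((hd'.hasFDerivAt.clm_apply (hasFDerivAt_const (w 1) x))
          |>.continuousMultilinear_apply_const (Fin.tail (Fin.tail w))).fderiv
        have h3 : (fun y => iteratedFDeriv ℝ (n + 1) f y (Fin.tail w)) =
            fun y => fderiv ℝ (iteratedFDeriv ℝ n f) y (w 1) (Fin.tail (Fin.tail w)) := by
          funext y
          rw [iteratedFDeriv_succ_apply_left]
          rfl
        rw [h3, h2] at h1
        have h4 := congrArg (fun L => L (w 0)) h1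
        rw [iteratedFDeriv_succ_apply_left]
        simpa using h4.symm
      rw [key, key]
      have h0 : (v ∘ Equiv.swap (Fin.castSucc (0 : Fin (n + 1))) (Fin.succ 0)) 0 = v 1 := by
        simp
      have h1 : (v ∘ Equiv.swap (Fin.castSucc (0 : Fin (n + 1))) (Fin.succ 0)) 1 = v 0 := by
        simp
      have h2 : Fin.tail (Fin.tail (v ∘ Equiv.swap (Fin.castSucc (0 : Fin (n + 1))) (Fin.succ 0)))
          = Fin.tail (Fin.tail v) := by
        funext l
        simp only [Fin.tail, Function.comp]
        rw [Equiv.swap_apply_of_ne_of_ne]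
        · simp
        · simp only [Fin.succ_zero_eq_one]
          intro h
          exact Fin.succ_ne_zero l (Fin.succ_injective _ h)
      rw [h0, h1, h2, hs.eq]
    · have hd : DifferentiableAt ℝ (iteratedFDeriv ℝ (n + 1) f) x :=
        hf.differentiableAt_iteratedFDeriv (by norm_cast; omega)
      have key : ∀ w : Fin (n + 1) → E,
          fderiv ℝ (iteratedFDeriv ℝ (n + 1) f) x (v 0) w =
            fderiv ℝ (fun y => iteratedFDeriv ℝ (n + 1) f y w) x (v 0) := by
        intro w
        rw [(hd.hasFDerivAt.continuousMultilinear_apply_const w).fderiv]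
        rfl
      have hev : ∀ᶠ y in nhds x, ContDiffAt ℝ (n + 1 : ℕ) f y :=
        (hf.of_le (by norm_cast; omega)).eventually (by simp)
      have h0 : (v ∘ Equiv.swap (Fin.castSucc i.succ) i.succ.succ) 0 = v 0 := by
        simp only [Function.comp]
        rw [Equiv.swap_apply_of_ne_of_ne]
        · simp [Fin.ext_iff]
        · simp [Fin.ext_iff]
      have h1 : Fin.tail (v ∘ Equiv.swap (Fin.castSucc i.succ) i.succ.succ) =
          Fin.tail v ∘ Equiv.swap i.castSucc i.succ := by
        funext l
        simp only [Fin.tail, Function.comp]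
        rw [← Fin.succ_castSucc, (Fin.succ_injective _).swap_apply]
      rw [iteratedFDeriv_succ_apply_left, iteratedFDeriv_succ_apply_left, h0, h1, key, key]
      congr 1
      apply Filter.EventuallyEq.fderiv_eq
      filter_upwards [hev] with y hy
      exact ih i hy _

theorem iteratedFDeriv_comp_perm_of_contDiffAt {n : ℕ} {f : E → F} {x : E}
    (hf : ContDiffAt ℝ n f x) (v : Fin n → E) (σ : Equiv.Perm (Fin n)) :
    iteratedFDeriv ℝ n f x (v ∘ σ) = iteratedFDeriv ℝ n f x v := by
  cases n with
  | zero => exact congrArg _ (Subsingleton.elim _ _)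
  | succ n =>
    have hσ : σ ∈ Submonoid.closure
        (Set.range fun i : Fin n => Equiv.swap i.castSucc i.succ) := by
      rw [Equiv.Perm.mclosure_swap_castSucc_succ]
      trivial
    induction hσ using Submonoid.closure_induction generalizing v with
    | mem σ h =>
      obtain ⟨i, rfl⟩ := h
      exact iteratedFDeriv_comp_adjacent_swap i hf v
    | one => rfl
    | mul σ τ _ _ h1 h2 =>
      rw [Equiv.Perm.coe_mul, ← Function.comp_assoc, h2, h1]

/-- If `r` misses an index `b`, flipping the sign `ε b` negates every summand, so the sum is zero.
-/
theorem sum_units_prod_mul_prod_comp {n : ℕ} (r : Fin n → Fin n) :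
    ∑ ε : Fin n → ℤˣ, (∏ i, ((ε i : ℤ) : ℝ)) * ∏ i, ((ε (r i) : ℤ) : ℝ) =
      if Function.Bijective r then 2 ^ n else 0 := by
  classical
  split_ifs with hr
  · have h : ∀ ε : Fin n → ℤˣ,
        (∏ i, ((ε i : ℤ) : ℝ)) * ∏ i, ((ε (r i) : ℤ) : ℝ) = 1 := by
      intro ε
      rw [hr.prod_comp (fun i => ((ε i : ℤ) : ℝ)), ← Finset.prod_mul_distrib]
      refine Finset.prod_eq_one fun i _ => ?_
      norm_cast
      simp
    simp [h]
  · have hs : ¬ Function.Surjective r := fun h => hr (Finite.surjective_iff_bijective.1 h)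
    simp only [Function.Surjective, not_forall, not_exists] at hs
    obtain ⟨b, hb⟩ := hs
    have h := Fintype.sum_equiv (Equiv.mulLeft (Pi.mulSingle b (-1) : Fin n → ℤˣ))
      (fun ε : Fin n → ℤˣ => (∏ i, ((ε i : ℤ) : ℝ)) * ∏ i, ((ε (r i) : ℤ) : ℝ))
      (fun ε : Fin n → ℤˣ => -((∏ i, ((ε i : ℤ) : ℝ)) * ∏ i, ((ε (r i) : ℤ) : ℝ))) ?_
    · rw [Finset.sum_neg_distrib] at h
      linarith
    · intro ε
      have h1 : ∀ i, (Pi.mulSingle b (-1) : Fin n → ℤˣ) (r i) = 1 := fun i =>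
        Pi.mulSingle_eq_of_ne (hb i) _
      have h2 : ∏ i, (((Pi.mulSingle b (-1) : Fin n → ℤˣ) i : ℤ) : ℝ) = -1 := by
        rw [Finset.prod_eq_single b]
        · simp
        · intro i _ hi
          simp [Pi.mulSingle_eq_of_ne hi]
        · simp
      simp only [Equiv.coe_mulLeft, Pi.mul_apply, h1, one_mul, Units.val_mul, Int.cast_mul,
        Finset.prod_mul_distrib, h2]
      ring

/-- The polarization identity writes `2^n n! A(v)` as a signed sum of `2^n` diagonal values, each
taken at a vector of norm at most `n`. -/
theorem norm_apply_le_of_symmetric {n : ℕ} (A : ContinuousMultilinearMap ℝ (fun _ : Fin n => E) F)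
    (hA : ∀ (v : Fin n → E) (σ : Equiv.Perm (Fin n)), A (v ∘ σ) = A v) {C : ℝ}
    (hC0 : 0 ≤ C) (hC : ∀ v : E, ‖A fun _ => v‖ ≤ C * ‖v‖ ^ n) {v : Fin n → E} (hv : ∀ i, ‖v i‖ ≤ 1) :
    (n.factorial : ℝ) * ‖A v‖ ≤ n ^ n * C := by
  classical
  have key : ∑ ε : Fin n → ℤˣ, (∏ i, ((ε i : ℤ) : ℝ)) • A (fun _ => ∑ i, ((ε i : ℤ) : ℝ) • v i) =
      ((2 : ℝ) ^ n * n.factorial) • A v := by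
    have h1 : ∀ ε : Fin n → ℤˣ, A (fun _ => ∑ i, ((ε i : ℤ) : ℝ) • v i) =
        ∑ r : Fin n → Fin n, (∏ i, ((ε (r i) : ℤ) : ℝ)) • A (v ∘ r) := by
      intro ε
      rw [A.map_sum]
      exact Finset.sum_congr rfl fun r _ => A.map_smul_univ _ _
    simp_rw [h1, Finset.smul_sum, smul_smul]
    rw [Finset.sum_comm]
    simp_rw [← Finset.sum_smul, sum_units_prod_mul_prod_comp, ite_smul, zero_smul]
    rw [← Finset.sum_filter]
    have h2 : ∀ r ∈ Finset.univ.filter (fun r : Fin n → Fin n => Function.Bijective r),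
        (2 : ℝ) ^ n • A (v ∘ r) = (2 : ℝ) ^ n • A v := by
      intro r hr
      rw [← hA v (Equiv.ofBijective r (Finset.mem_filter.1 hr).2)]
      rfl
    rw [Finset.sum_congr rfl h2, Finset.sum_const]
    have h3 : (Finset.univ.filter (fun r : Fin n → Fin n => Function.Bijective r)).card =
        n.factorial := by
      rw [← Fintype.card_subtype, ← Fintype.card_congr (Equiv.ofBijective
        (fun σ : Equiv.Perm (Fin n) => (⟨σ, σ.bijective⟩ : {r : Fin n → Fin n //
          Function.Bijective r})) ⟨fun a b h => Equiv.ext fun x => congrFun (congrArg Subtype.val h) x,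
            fun r => ⟨Equiv.ofBijective r.1 r.2, rfl⟩⟩), Fintype.card_perm, Fintype.card_fin]
    rw [h3, ← Nat.cast_smul_eq_nsmul ℝ, smul_smul, mul_comm]
  have hb : ∀ ε : Fin n → ℤˣ,
      ‖(∏ i, ((ε i : ℤ) : ℝ)) • A (fun _ => ∑ i, ((ε i : ℤ) : ℝ) • v i)‖ ≤ C * n ^ n := by
    intro ε
    have hε : ∀ i, ‖((ε i : ℤ) : ℝ)‖ = 1 := by
      intro i
      rcases Int.units_eq_one_or (ε i) with h | h <;> simp [h]
    rw [norm_smul, norm_prod, Finset.prod_congr rfl fun i _ => hε i, Finset.prod_const_one,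
      one_mul]
    refine (hC _).trans ?_
    have hsum : ‖∑ i, ((ε i : ℤ) : ℝ) • v i‖ ≤ n := by
      refine (norm_sum_le _ _).trans ?_
      calc ∑ i, ‖((ε i : ℤ) : ℝ) • v i‖ ≤ ∑ _i : Fin n, (1 : ℝ) := by
            refine Finset.sum_le_sum fun i _ => ?_
            rw [norm_smul, hε, one_mul]
            exact hv i
        _ = n := by simp
    gcongr
  have hn : ‖((2 : ℝ) ^ n * n.factorial) • A v‖ ≤ 2 ^ n * (C * n ^ n) := by
    rw [← key]
    refine (norm_sum_le _ _).trans ((Finset.sum_le_sum fun ε _ => hb ε).trans ?_)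
    simp
  rw [norm_smul, Real.norm_of_nonneg (by positivity), mul_assoc] at hn
  have := le_of_mul_le_mul_left hn (by positivity)
  linarith

end Symmetry

/-! ### Approximating the kernel by finitely many functions of `y` -/

/-- If `h` is annihilated by all `∫ φ_i h`, the approximating sum may be subtracted from the kernel
without changing `T h`. The coefficients are chosen separately for each `x`, so they need no
regularity in `x`. -/
theorem nthEigenvalue_le_of_kernel_approx {m : ℕ} {U : Set (EuclideanSpace ℝ (Fin m))}
    (hUo : IsOpen U) (hUb : Bornology.IsBounded U)
    {F : EuclideanSpace ℝ (Fin m) → EuclideanSpace ℝ (Fin m) → ℂ}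
    {T : L2 U →L[ℂ] L2 U} (hT : IsIntegralOperator U F T) (hp : T.IsPositive)
    (hF : ∀ x ∈ U, ContinuousOn (F x) U)
    {J : Type} [Fintype J] (φ : J → EuclideanSpace ℝ (Fin m) → ℂ) (hφm : ∀ i, Measurable (φ i))
    (hφb : ∀ i, ∃ C : ℝ, ∀ y ∈ U, ‖φ i y‖ ≤ C) {E : ℝ} (hE : 0 ≤ E)
    (happ : ∀ x ∈ U, ∃ c : J → ℂ, ∀ y ∈ U, ‖F x y - ∑ i, c i * φ i y‖ ≤ E)
    {n : ℕ} (hn : Fintype.card J < n) : nthEigenvalue T n ≤ E * volume.real U := by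
  have : IsFiniteMeasure ((volume : Measure (EuclideanSpace ℝ (Fin m))).restrict U) :=
    ⟨by simpa using hUb.measure_lt_top⟩
  have hI : ∀ h : L2 U, Integrable h (volume.restrict U) := fun h =>
    (Lp.memLp h).integrable (by norm_num)
  have hφI : ∀ i (h : L2 U), Integrable (fun y => φ i y * h y) (volume.restrict U) := by
    intro i h
    obtain ⟨C, hC⟩ := hφb i
    refine (hI h).bdd_mul (c := C) (hφm i).aestronglyMeasurable ?_
    exact (ae_restrict_iff' hUo.measurableSet).2 (.of_forall hC)
  let l : J → L2 U →ₗ[ℂ] ℂ := fun i =>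
    { toFun := fun h => ∫ y in U, φ i y * h y
      map_add' := by
        intro h g
        rw [← integral_add (hφI i h) (hφI i g)]
        refine integral_congr_ae ?_
        filter_upwards [Lp.coeFn_add h g] with y hy
        rw [hy, Pi.add_apply, mul_add]
      map_smul' := by
        intro c h
        rw [RingHom.id_apply, smul_eq_mul, ← integral_const_mul]
        refine integral_congr_ae ?_
        filter_upwards [Lp.coeFn_smul c h] with y hy
        rw [hy, Pi.smul_apply, smul_eq_mul]
        ring }
  refine nthEigenvalue_le_of_functionals hp.isSymmetric l hn
    (mul_nonneg hE measureReal_nonneg) fun h hl => ?_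
  refine norm_integralOperator_le hUb hE ?_
  filter_upwards [hT h, ae_restrict_mem hUo.measurableSet] with x hx hxU
  obtain ⟨c, hc⟩ := happ x hxU
  have hsum : Integrable (fun y => ∑ i, c i * (φ i y * h y)) (volume.restrict U) :=
    integrable_finsetSum _ fun i _ => (hφI i h).const_mul (c i)
  have hbound : ∀ᵐ y ∂((volume : Measure (EuclideanSpace ℝ (Fin m))).restrict U),
      ‖F x y - ∑ i, c i * φ i y‖ ≤ E :=
    (ae_restrict_iff' hUo.measurableSet).2 (.of_forall (hc))
  have hrem : Integrable (fun y => (F x y - ∑ i, c i * φ i y) * h y) (volume.restrict U) := by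
    refine (hI h).bdd_mul (c := E) ?_ hbound
    refine ((hF x hxU).aestronglyMeasurable hUo.measurableSet).sub ?_
    exact (Finset.measurable_fun_sum _ fun i _ => (hφm i).const_mul (c i)).aestronglyMeasurable
  have h0 : ∫ y in U, ∑ i, c i * (φ i y * h y) = 0 := by
    rw [integral_finsetSum _ fun i _ => (hφI i h).const_mul (c i)]
    refine Finset.sum_eq_zero fun i _ => ?_
    rw [integral_const_mul]
    have : ∫ y in U, φ i y * h y = 0 := hl i
    rw [this, mul_zero]
  have hT' : T h x = ∫ y in U, (F x y - ∑ i, c i * φ i y) * h y := by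
    rw [hx, ← add_zero (∫ y in U, (F x y - ∑ i, c i * φ i y) * h y), ← h0,
      ← integral_add hrem hsum]
    refine integral_congr_ae (.of_forall fun y => ?_)
    simp only [sub_mul, Finset.sum_mul, mul_assoc]
    ring
  rw [hT', ← integral_const_mul]
  refine norm_integral_le_of_norm_le ((hI h).norm.const_mul E) ?_
  filter_upwards [hbound] with y hy
  rw [norm_mul]
  gcongr

/-! ### Taylor's formula along polygonal paths -/

/-- `PolygonalReach V x y l`: the point `y` is the end of a polygonal path in `V` that starts at
`x` and has length `l`. -/
inductive PolygonalReach {E : Type} [NormedAddCommGroup E] [NormedSpace ℝ E] (V : Set E) (x : E) :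
    E → ℝ → Prop
  | refl : PolygonalReach V x x 0
  | step {y z : E} {l : ℝ} : PolygonalReach V x y l → segment ℝ y z ⊆ V →
      PolygonalReach V x z (l + dist y z)

section Taylor

variable {E F : Type} [NormedAddCommGroup E] [NormedSpace ℝ E] [NormedAddCommGroup F]
  [NormedSpace ℝ F]

theorem PolygonalReach.nonneg {V : Set E} {x y : E} {l : ℝ} (h : PolygonalReach V x y l) :
    0 ≤ l := by
  induction h with
  | refl => exact le_rfl
  | step _ _ ih => positivity

/-- The Taylor polynomial of `f` at `x` of degree less than `j`. -/
noncomputable def taylorPoly (f : E → F) (x : E) (j : ℕ) (y : E) : F :=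
  ∑ i ∈ Finset.range j, ((i.factorial : ℝ)⁻¹) • iteratedFDeriv ℝ i f x fun _ => y - x

/-- The product rule gives one term per slot, and by symmetry the `i + 1` terms agree. -/
theorem hasFDerivAt_iteratedFDeriv_diag {i : ℕ} {f : E → F} {x : E}
    (hf : ContDiffAt ℝ (i + 1 : ℕ) f x) (y : E) :
    HasFDerivAt (fun z => iteratedFDeriv ℝ (i + 1) f x fun _ => z - x)
      (((i : ℝ) + 1) • iteratedFDeriv ℝ i (fderiv ℝ f) x fun _ => y - x) y := by
  classical
  set A := iteratedFDeriv ℝ (i + 1) f x with hA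
  have h := HasFDerivAt.multilinear_comp A
    (g := fun (_ : Fin (i + 1)) (z : E) => z - x) (x := y) fun _ => (hasFDerivAt_id y).sub_const x
  convert h using 1
  ext v
  have hsymm : ∀ k : Fin (i + 1), A (Function.update (fun _ => y - x) k v) =
      iteratedFDeriv ℝ i (fderiv ℝ f) x (fun _ => y - x) v := by
    intro k
    have h1 := iteratedFDeriv_succ_apply_right (𝕜 := ℝ) (f := f) (x := x) (n := i)
      (Function.update (fun _ => y - x) (Fin.last i) v)
    have h2 : Fin.init (Function.update (fun _ : Fin (i + 1) => y - x) (Fin.last i) v) =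
        fun _ => y - x := by
      funext l
      simp [Fin.init]
    rw [h2, Function.update_self] at h1
    rw [← h1, ← iteratedFDeriv_comp_perm_of_contDiffAt hf _ (Equiv.swap (Fin.last i) k)]
    congr 1
    funext l
    simp only [Function.comp, Function.update_apply]
    simp only [Equiv.swap_apply_eq_iff, Equiv.swap_apply_right]
  simp [hsymm, ← Nat.cast_smul_eq_nsmul ℝ]

theorem hasFDerivAt_taylorPoly {j : ℕ} {f : E → F} {x : E} (hf : ContDiffAt ℝ j f x) (y : E) :
    HasFDerivAt (taylorPoly f x (j + 1)) (taylorPoly (fderiv ℝ f) x j y) y := by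
  have h1 : taylorPoly f x (j + 1) = fun z => (∑ i ∈ Finset.range j,
      (((i + 1).factorial : ℝ)⁻¹) • iteratedFDeriv ℝ (i + 1) f x fun _ => z - x) + f x := by
    funext z
    rw [taylorPoly, Finset.sum_range_succ']
    simp
  rw [h1]
  refine HasFDerivAt.add_const _ ?_
  refine HasFDerivAt.fun_sum fun i hi => ?_
  have hi' : i + 1 ≤ j := Finset.mem_range.1 hi
  have h2 := (hasFDerivAt_iteratedFDeriv_diag (hf.of_le (by exact_mod_cast hi')) y).const_smul
    (((i + 1).factorial : ℝ)⁻¹)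
  refine h2.congr_fderiv ?_
  rw [smul_smul]
  congr 1
  rw [Nat.factorial_succ]
  push_cast
  field_simp

theorem taylorPoly_succ_self (f : E → F) (x : E) (j : ℕ) : taylorPoly f x (j + 1) x = f x := by
  rw [taylorPoly, Finset.sum_range_succ']
  simp only [sub_self, Nat.factorial_zero, Nat.cast_one, inv_one, iteratedFDeriv_zero_apply,
    one_smul, add_eq_right]
  exact Finset.sum_eq_zero fun i _ => by
    rw [(iteratedFDeriv ℝ (i + 1) f x).map_coord_zero 0 rfl, smul_zero]

/-- The derivative of the remainder of `f` is the remainder of `fderiv ℝ f` of one order less.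
Induction on `j`, for all target spaces at once, bounds it, and integration along the path, one
segment at a time, gives the next order. -/
theorem norm_sub_taylorPoly_le {V : Set E} (hV : IsOpen V) {x : E} (hx : x ∈ V) {B : ℝ}
    (j : ℕ) : ∀ {F : Type} [NormedAddCommGroup F] [NormedSpace ℝ F] {f : E → F},
    ContDiffOn ℝ j f V → (∀ y ∈ V, ‖iteratedFDeriv ℝ j f y‖ ≤ B) →
    ∀ {y : E} {l : ℝ}, PolygonalReach V x y l →
      ‖f y - taylorPoly f x j y‖ ≤ B * l ^ j / j.factorial := by
  induction j with
  | zero =>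
    intro F _ _ f hf hB y l h
    have hy : y ∈ V := by
      cases h with
      | refl => exact hx
      | step _ h => exact h (right_mem_segment _ _ _)
    simpa [taylorPoly] using hB y hy
  | succ j ih =>
    intro F _ _ f hf hB y l h
    have hfd : ContDiffOn ℝ j (fderiv ℝ f) V := hf.fderiv_of_isOpen hV (by norm_cast)
    have hBd : ∀ y ∈ V, ‖iteratedFDeriv ℝ j (fderiv ℝ f) y‖ ≤ B := by
      intro y hy
      rw [norm_iteratedFDeriv_fderiv]
      exact hB y hy
    have hB0 : 0 ≤ B := (norm_nonneg _).trans (hB x hx)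
    have hx' : ContDiffAt ℝ j f x :=
      (hf.contDiffAt (hV.mem_nhds hx)).of_le (by norm_cast; omega)
    have hder : ∀ z ∈ V, HasFDerivAt (fun z => f z - taylorPoly f x (j + 1) z)
        (fderiv ℝ f z - taylorPoly (fderiv ℝ f) x j z) z := fun z hz =>
      (((hf.contDiffAt (hV.mem_nhds hz)).differentiableAt (by norm_cast)).hasFDerivAt).sub
        (hasFDerivAt_taylorPoly hx' z)
    induction h with
    | refl => simp [taylorPoly_succ_self]
    | @step y z l hr hs ihr =>
      have hl := hr.nonneg
      set d := dist y z with hd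
      have hd0 : 0 ≤ d := dist_nonneg
      have hmem : ∀ t ∈ Icc (0 : ℝ) 1, y + t • (z - y) ∈ segment ℝ y z := by
        intro t ht
        rw [segment_eq_image']
        exact ⟨t, ht, rfl⟩
      have hpt : ∀ t ∈ Icc (0 : ℝ) 1, PolygonalReach V x (y + t • (z - y)) (l + t * d) := by
        intro t ht
        have h1 : dist y (y + t • (z - y)) = t * d := by
          rw [dist_self_add_right, norm_smul, Real.norm_of_nonneg ht.1, hd, dist_comm y z,
            dist_eq_norm]
        rw [← h1]
        exact hr.step (((convex_segment y z).segment_subset (left_mem_segment _ _ _)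
          (hmem t ht)).trans hs)
      have hlin : ∀ t : ℝ, HasDerivAt (fun t : ℝ => y + t • (z - y)) (z - y) t := by
        intro t
        simpa using ((hasDerivAt_id t).smul_const (z - y)).const_add y
      have hg : ∀ t ∈ Icc (0 : ℝ) 1,
          HasDerivAt (fun t : ℝ => f (y + t • (z - y)) - taylorPoly f x (j + 1) (y + t • (z - y)))
            ((fderiv ℝ f (y + t • (z - y)) - taylorPoly (fderiv ℝ f) x j (y + t • (z - y)))
              (z - y)) t := fun t ht =>
        by
        simpa [Function.comp_def] using
          HasFDerivAt.comp_hasDerivAt t (hder _ (hs (hmem t ht))) (hlin t)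
      have hB' : ∀ t : ℝ, HasDerivAt (fun t : ℝ => B * (l + t * d) ^ (j + 1) / (j + 1).factorial)
          (B * (l + t * d) ^ j / j.factorial * d) t := by
        intro t
        have h1 : HasDerivAt (fun t : ℝ => l + t * d) d t := by
          simpa using ((hasDerivAt_id t).mul_const d).const_add l
        have h2 := ((h1.pow (j + 1)).const_mul B).div_const ((j + 1).factorial : ℝ)
        refine h2.congr_deriv ?_
        rw [Nat.factorial_succ]
        push_cast
        field_simp
      -- On the last segment the remainder is compared with `B (l + t d)^(j+1)/(j+1)!`, which
      -- dominates it at `t = 0` by the induction along the path and has the larger derivative.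
      have := image_norm_le_of_norm_deriv_right_le_deriv_boundary
        (f := fun t : ℝ => f (y + t • (z - y)) - taylorPoly f x (j + 1) (y + t • (z - y)))
        (a := 0) (b := 1)
        (fun t ht => (hg t ht).continuousAt.continuousWithinAt)
        (fun t ht => (hg t (Ico_subset_Icc_self ht)).hasDerivWithinAt) (by simpa using ihr)
        hB' (fun t ht => ?_) (right_mem_Icc.2 zero_le_one)
      · simpa using this
      · refine (ContinuousLinearMap.le_opNorm _ _).trans ?_
        rw [hd, dist_comm y z, dist_eq_norm z y]
        gcongr
        have := ih hfd hBd (hpt t (Ico_subset_Icc_self ht))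
        rwa [hd, dist_comm y z, dist_eq_norm z y] at this

end Taylor

/-! ### Taylor polynomials as combinations of monomials -/

/-- The monomial `∏ (y - c)_l ^ α_l` in the coordinates of `y - c`. -/
noncomputable def shiftedMonomial {m j : ℕ} (c : EuclideanSpace ℝ (Fin m)) (α : Fin m → Fin j)
    (y : EuclideanSpace ℝ (Fin m)) : ℂ :=
  ∏ l, (((y - c) l : ℝ) : ℂ) ^ (α l : ℕ)

theorem continuous_shiftedMonomial {m j : ℕ} (c : EuclideanSpace ℝ (Fin m)) (α : Fin m → Fin j) :
    Continuous (shiftedMonomial c α) := by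
  unfold shiftedMonomial
  fun_prop

theorem exists_taylorPoly_eq_sum_shiftedMonomial {m : ℕ} (f : EuclideanSpace ℝ (Fin m) → ℂ)
    (x : EuclideanSpace ℝ (Fin m)) (j : ℕ) :
    ∃ c : (Fin m → Fin j) → ℂ, ∀ y, taylorPoly f x j y = ∑ α, c α * shiftedMonomial x α y := by
  suffices h : taylorPoly f x j ∈ Submodule.span ℂ
      (Set.range (shiftedMonomial x : (Fin m → Fin j) → _ → ℂ)) by
    obtain ⟨c, hc⟩ := Submodule.mem_span_range_iff_exists_fun ℂ |>.1 h
    refine ⟨c, fun y => ?_⟩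
    rw [← hc, Finset.sum_apply]
    simp
  have hsum : taylorPoly f x j = ∑ i ∈ Finset.range j, fun y =>
      ((i.factorial : ℝ)⁻¹) • iteratedFDeriv ℝ i f x fun _ => y - x := by
    funext y
    simp [taylorPoly]
  rw [hsum]
  refine Submodule.sum_mem _ fun i hi => ?_
  have hij : i < j := Finset.mem_range.1 hi
  -- The exponent of a coordinate is the number of slots filled with it, at most `i < j`. So the
  -- `j^m` monomials with exponents below `j` suffice.
  let α : (Fin i → Fin m) → Fin m → Fin j := fun r l =>
    ⟨(Finset.univ.filter fun s => r s = l).card,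
      ((Finset.card_le_univ _).trans_eq (Fintype.card_fin i)).trans_lt hij⟩
  have hexp : (fun y => ((i.factorial : ℝ)⁻¹) • iteratedFDeriv ℝ i f x fun _ => y - x) =
      ∑ r : Fin i → Fin m, ((((i.factorial : ℝ)⁻¹ : ℝ) : ℂ) *
        iteratedFDeriv ℝ i f x fun s => EuclideanSpace.single (r s) (1 : ℝ)) •
        shiftedMonomial x (α r) := by
    funext y
    have h1 : y - x = ∑ l, (y - x) l • EuclideanSpace.single l (1 : ℝ) := by
      ext l
      simp [Finset.sum_apply, Pi.single_apply]
    have h2 : (iteratedFDeriv ℝ i f x fun _ => y - x) = ∑ r : Fin i → Fin m,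
        (∏ s, (y - x) (r s)) •
          iteratedFDeriv ℝ i f x fun s => EuclideanSpace.single (r s) (1 : ℝ) := by
      conv_lhs => rw [h1]
      rw [ContinuousMultilinearMap.map_sum]
      exact Finset.sum_congr rfl fun r _ => ContinuousMultilinearMap.map_smul_univ _ _ _
    have h3 : ∀ r : Fin i → Fin m, ((∏ s, (y - x) (r s) : ℝ) : ℂ) =
        shiftedMonomial x (α r) y := by
      intro r
      rw [shiftedMonomial, Complex.ofReal_prod,
        ← Finset.prod_fiberwise' Finset.univ r (fun l => (((y - x) l : ℝ) : ℂ))]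
      exact Finset.prod_congr rfl fun l _ => Finset.prod_const _
    rw [h2, Finset.smul_sum, Finset.sum_apply]
    refine Finset.sum_congr rfl fun r _ => ?_
    rw [Pi.smul_apply, ← h3, Complex.real_smul, Complex.real_smul, smul_eq_mul]
    ring
  rw [hexp]
  exact Submodule.sum_mem _ fun r _ =>
    Submodule.smul_mem _ _ (Submodule.subset_span (Set.mem_range_self _))

/-! ### Derivatives of slices and along lines -/

section Slices

variable {E F G : Type} [NormedAddCommGroup E] [NormedSpace ℝ E] [NormedAddCommGroup F]
  [NormedSpace ℝ F] [NormedAddCommGroup G] [NormedSpace ℝ G]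

theorem iteratedFDeriv_comp_affine {W : Set E} (hW : IsOpen W) {f : E → F} {k j : ℕ}
    (hf : ContDiffOn ℝ k f W) (hj : j ≤ k) (a : E) (g : G →L[ℝ] E) {z : G} (hz : a + g z ∈ W) :
    iteratedFDeriv ℝ j (fun z => f (a + g z)) z =
      (iteratedFDeriv ℝ j f (a + g z)).compContinuousLinearMap fun _ => g := by
  set W' : Set E := (fun e => a + e) ⁻¹' W
  have hW' : IsOpen W' := hW.preimage (by fun_prop)
  have hf' : ContDiffOn ℝ k (fun e => f (a + e)) W' :=
    hf.comp (contDiff_const.add contDiff_id).contDiffOn fun e he => he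
  have hgW : IsOpen (g ⁻¹' W') := hW'.preimage g.continuous
  have h := g.iteratedFDerivWithin_comp_right hf' hW'.uniqueDiffOn hgW.uniqueDiffOn (x := z) hz
    (i := j) (by exact_mod_cast hj)
  rw [iteratedFDerivWithin_of_isOpen j hgW hz, iteratedFDerivWithin_of_isOpen j hW' hz,
    iteratedFDeriv_comp_add_left] at h
  exact h

theorem contDiffOn_slice {W : Set (E × E)} {f : E → E → F} {k : ℕ}
    (hf : ContDiffOn ℝ k (Function.uncurry f) W) {x : E} {V : Set E} (hV : ∀ y ∈ V, (x, y) ∈ W) :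
    ContDiffOn ℝ k (f x) V :=
  hf.comp (contDiff_const.prodMk contDiff_id).contDiffOn hV

theorem norm_iteratedFDeriv_slice_le {W : Set (E × E)} (hW : IsOpen W) {f : E → E → F} {k j : ℕ}
    (hf : ContDiffOn ℝ k (Function.uncurry f) W) (hj : j ≤ k) {x y : E} (h : (x, y) ∈ W) :
    ‖iteratedFDeriv ℝ j (f x) y‖ ≤ ‖iteratedFDeriv ℝ j (Function.uncurry f) (x, y)‖ := by
  have h1 := iteratedFDeriv_comp_affine hW hf hj (x, 0) (ContinuousLinearMap.inr ℝ E E) (z := y)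
    (by simpa using h)
  have h2 : (fun z => Function.uncurry f ((x, 0) + ContinuousLinearMap.inr ℝ E E z)) = f x := by
    funext z
    simp
  rw [h2] at h1
  rw [h1]
  refine (ContinuousMultilinearMap.norm_compContinuousLinearMap_le _ _).trans ?_
  have h3 : ((x, 0) + ContinuousLinearMap.inr ℝ E E y : E × E) = (x, y) := by simp
  rw [h3, Finset.prod_const]
  exact mul_le_of_le_one_right (norm_nonneg _)
    (pow_le_one₀ (norm_nonneg _) (ContinuousLinearMap.norm_inr_le_one ℝ E E))

theorem iteratedDeriv_line {V : Set E} (hV : IsOpen V) {f : E → F} {k j : ℕ}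
    (hf : ContDiffOn ℝ k f V) (hj : j ≤ k) {y : E} (hy : y ∈ V) (v : E) :
    iteratedDeriv j (fun s : ℝ => f (y + s • v)) 0 = iteratedFDeriv ℝ j f y fun _ => v := by
  have h1 := iteratedFDeriv_comp_affine hV hf hj y (ContinuousLinearMap.toSpanSingleton ℝ v)
    (z := 0) (by simpa using hy)
  rw [iteratedDeriv_eq_iteratedFDeriv]
  simp only [ContinuousLinearMap.toSpanSingleton_apply] at h1
  rw [h1]
  simp

end Slices

/-! ### Piecewise Taylor approximation on cells and cubes -/

theorem nthEigenvalue_le_of_cells {m : ℕ} {U : Set (EuclideanSpace ℝ (Fin m))}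
    (hUo : IsOpen U) (hUb : Bornology.IsBounded U)
    {F : EuclideanSpace ℝ (Fin m) → EuclideanSpace ℝ (Fin m) → ℂ}
    {T : L2 U →L[ℂ] L2 U} (hT : IsIntegralOperator U F T) (hp : T.IsPositive)
    {V : Set (EuclideanSpace ℝ (Fin m))} (hV : IsOpen V) (hUV : U ⊆ V) {j : ℕ}
    (hF : ∀ x ∈ U, ContDiffOn ℝ j (F x) V) {B : ℝ}
    (hB : ∀ x ∈ U, ∀ y ∈ V, ‖iteratedFDeriv ℝ j (F x) y‖ ≤ B)
    {ι : Type} [Fintype ι] (π : EuclideanSpace ℝ (Fin m) → ι)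
    (hπ : ∀ i, MeasurableSet {y | y ∈ U ∧ π y = i}) {E : ℝ} (hE : 0 ≤ E)
    (hreach : ∀ y ∈ U, ∀ z ∈ U, π y = π z →
      ∃ l, PolygonalReach V y z l ∧ B * l ^ j / j.factorial ≤ E)
    {n : ℕ} (hn : Fintype.card ι * j ^ m < n) : nthEigenvalue T n ≤ E * volume.real U := by
  classical
  -- A base point in each nonempty cell; empty cells get the irrelevant value `0`.
  have hb : ∀ i, ∃ b, ∀ y ∈ U, π y = i → b ∈ U ∧ π b = i := by
    intro i
    by_cases h : ∃ y ∈ U, π y = i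
    · obtain ⟨y, hy⟩ := h
      exact ⟨y, fun _ _ _ => hy⟩
    · push Not at h
      exact ⟨0, fun y hy hyi => absurd hyi (h y hy)⟩
  choose b hb using hb
  let φ : ι × (Fin m → Fin j) → EuclideanSpace ℝ (Fin m) → ℂ := fun p =>
    indicator {y | y ∈ U ∧ π y = p.1} (shiftedMonomial (b p.1) p.2)
  refine nthEigenvalue_le_of_kernel_approx hUo hUb hT hp
    (fun x hx => (hF x hx).continuousOn.mono hUV) φ
    (fun p => (continuous_shiftedMonomial _ _).measurable.indicator (hπ _)) (fun p => ?_) hE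
    (fun x hx => ?_) (by simpa using hn)
  · obtain ⟨C, hC⟩ := hUb.isCompact_closure.exists_bound_of_continuousOn
      (continuous_shiftedMonomial (b p.1) p.2).continuousOn
    exact ⟨C, fun y hy => (norm_indicator_le_norm_self _ _).trans (hC y (subset_closure hy))⟩
  · choose c hc using fun i => exists_taylorPoly_eq_sum_shiftedMonomial (F x) (b i) j
    refine ⟨fun p => c p.1 p.2, fun y hy => ?_⟩
    obtain ⟨hbU, hbπ⟩ := hb (π y) y hy rfl
    obtain ⟨l, hl, hlE⟩ := hreach _ hbU y hy hbπ
    have hsum : ∑ p : ι × (Fin m → Fin j), c p.1 p.2 * φ p y = taylorPoly (F x) (b (π y)) j y := by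
      rw [Fintype.sum_prod_type, Finset.sum_eq_single (π y), hc]
      · refine Finset.sum_congr rfl fun α _ => ?_
        simp [φ, hy]
      · intro i _ hi
        refine Finset.sum_eq_zero fun α _ => ?_
        simp [φ, hi.symm]
      · simp
    rw [hsum]
    exact (norm_sub_taylorPoly_le hV (hUV hbU) j (hF x hx) (hB x hx) hl).trans hlE

/-- The index of the cube containing `y` when `[-R, R)^m` is cut into `q^m` equal cubes. -/
noncomputable def cubeIndex {m : ℕ} (R : ℝ) (q : ℕ) [NeZero q] (y : EuclideanSpace ℝ (Fin m)) :
    Fin m → Fin q :=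
  fun l => Fin.ofNat q ⌊(y l + R) * q / (2 * R)⌋₊

theorem measurable_cubeIndex {m : ℕ} (R : ℝ) (q : ℕ) [NeZero q] :
    Measurable (cubeIndex R q : EuclideanSpace ℝ (Fin m) → Fin m → Fin q) := by
  refine measurable_pi_lambda _ fun l => ?_
  exact (measurable_from_top (f := Fin.ofNat q)).comp
    (Nat.measurable_floor.comp (by fun_prop))

theorem dist_le_of_cubeIndex_eq {m : ℕ} {R : ℝ} {q : ℕ} [NeZero q]
    {y z : EuclideanSpace ℝ (Fin m)} (hy : y ∈ Metric.ball 0 R) (hz : z ∈ Metric.ball 0 R)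
    (h : cubeIndex R q y = cubeIndex R q z) : dist y z ≤ m * (2 * R / q) := by
  have hR : 0 < R := (norm_nonneg y).trans_lt (by simpa using hy)
  have hq : (0 : ℝ) < q := Nat.cast_pos.2 (NeZero.pos q)
  -- Inside the ball the floor lies below `q`, so the reduction modulo `q` in `Fin.ofNat` changes
  -- nothing.
  have hrange : ∀ w ∈ Metric.ball (0 : EuclideanSpace ℝ (Fin m)) R, ∀ l,
      0 ≤ (w l + R) * q / (2 * R) ∧ ⌊(w l + R) * q / (2 * R)⌋₊ < q := by
    intro w hw l
    have h1 : |w l| < R := (PiLp.norm_apply_le w l).trans_lt (by simpa using hw)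
    obtain ⟨h2, h3⟩ := abs_lt.1 h1
    have h4 : 0 ≤ (w l + R) * q / (2 * R) := by
      have : 0 < w l + R := by linarith
      positivity
    refine ⟨h4, (Nat.floor_lt h4).2 ?_⟩
    rw [div_lt_iff₀ (by positivity), mul_comm]
    gcongr
    linarith
  have hcoord : ∀ l, |(y - z) l| ≤ 2 * R / q := by
    intro l
    obtain ⟨hy0, hyq⟩ := hrange y hy l
    obtain ⟨hz0, hzq⟩ := hrange z hz l
    have h1 := congrArg Fin.val (congrFun h l)
    simp only [cubeIndex, Fin.val_ofNat, Nat.mod_eq_of_lt hyq, Nat.mod_eq_of_lt hzq] at h1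
    have h2 := Nat.floor_le hy0
    have h3 := Nat.floor_le hz0
    have h4 := Nat.lt_floor_add_one ((y l + R) * q / (2 * R))
    have h5 := Nat.lt_floor_add_one ((z l + R) * q / (2 * R))
    rw [h1] at h2 h4
    have h6 : (y - z) l = ((y l + R) * q / (2 * R) - (z l + R) * q / (2 * R)) * (2 * R / q) := by
      simp only [PiLp.sub_apply]
      field_simp
      ring
    rw [h6, abs_mul, abs_of_pos (show 0 < 2 * R / q by positivity)]
    refine mul_le_of_le_one_left (by positivity) ?_
    rw [abs_le]
    constructor <;> linarith
  rw [dist_eq_norm, EuclideanSpace.norm_eq]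
  refine Real.sqrt_le_iff.2 ⟨by positivity, ?_⟩
  calc ∑ l, ‖(y - z) l‖ ^ 2 ≤ ∑ _l : Fin m, (2 * R / q) ^ 2 := by
        refine Finset.sum_le_sum fun l _ => ?_
        rw [Real.norm_eq_abs]
        gcongr
        exact hcoord l
    _ = m * (2 * R / q) ^ 2 := by simp
    _ ≤ m ^ 2 * (2 * R / q) ^ 2 := by
        gcongr
        exact_mod_cast Nat.le_self_pow two_ne_zero m
    _ = _ := by ring

theorem nthEigenvalue_le_of_quasiconvex {m : ℕ} (hm : 1 ≤ m)
    {U : Set (EuclideanSpace ℝ (Fin m))} (hUo : IsOpen U) {R : ℝ} (hR : 0 < R)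
    (hUR : U ⊆ Metric.ball 0 R) {V : Set (EuclideanSpace ℝ (Fin m))} (hV : IsOpen V) (hUV : U ⊆ V)
    {r C : ℝ} (hr : 0 < r)
    (hreach : ∀ y ∈ U, ∀ z ∈ U, dist y z < r → ∃ l, PolygonalReach V y z l ∧ l ≤ C * dist y z)
    {F : EuclideanSpace ℝ (Fin m) → EuclideanSpace ℝ (Fin m) → ℂ}
    {T : L2 U →L[ℂ] L2 U} (hT : IsIntegralOperator U F T) (hp : T.IsPositive) {j : ℕ}
    (hF : ∀ x ∈ U, ContDiffOn ℝ j (F x) V) {B : ℝ} (hB0 : 0 ≤ B)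
    (hB : ∀ x ∈ U, ∀ y ∈ V, ‖iteratedFDeriv ℝ j (F x) y‖ ≤ B)
    (hC : 0 ≤ C) {a : ℝ} (ha : 1 ≤ a) (har : 4 * m * R < a * r) {n : ℕ}
    (hn : a * ((j : ℝ) + m) ≤ ((n : ℝ) / 2) ^ ((1 : ℝ) / m)) :
    nthEigenvalue T n ≤ B * (4 * C * m * R * (j + m) * (2 / (n : ℝ)) ^ ((1 : ℝ) / m)) ^ j /
      j.factorial * volume.real U := by
  have hm0 : (1 : ℝ) ≤ m := by exact_mod_cast hm
  set X : ℝ := ((n : ℝ) / 2) ^ ((1 : ℝ) / m) with hX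
  have hjm : (0 : ℝ) < (j : ℝ) + m := by positivity
  have hX0 : 0 < X := lt_of_lt_of_le (by positivity) hn
  have hinv : (2 / (n : ℝ)) ^ ((1 : ℝ) / m) = X⁻¹ := by
    rw [hX, ← Real.inv_rpow (by positivity), inv_div]
  have hXm : X ^ m = n / 2 := by
    rw [hX, one_div, Real.rpow_inv_natCast_pow (by positivity) (by omega)]
  have hXa : a ≤ X / (j + m) := (le_div_iff₀ hjm).2 hn
  -- Since `a ≥ 1`, the quotient is at least `1`; hence `q ≥ 1`, and rounding down loses at most a
  -- factor `2`.
  set q : ℕ := ⌊X / (j + m)⌋₊ with hq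
  have hq1 : 1 ≤ q := Nat.one_le_floor_iff _ |>.2 (ha.trans hXa)
  have hq1' : (1 : ℝ) ≤ q := by exact_mod_cast hq1
  have : NeZero q := ⟨by omega⟩
  have hqle : (q : ℝ) ≤ X / (j + m) := Nat.floor_le (by positivity)
  have hqge : X / (j + m) ≤ 2 * q := by
    have := Nat.lt_floor_add_one (X / ((j : ℝ) + m))
    linarith
  have hside : m * (2 * R / q) ≤ 4 * m * R * ((j + m) * X⁻¹) := by
    have h1 : (1 : ℝ) / q ≤ 2 * ((j + m) * X⁻¹) := by
      rw [div_le_iff₀ (by positivity)]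
      rw [div_le_iff₀ hjm] at hqge
      field_simp
      linarith
    calc m * (2 * R / q) = 2 * m * R * (1 / q) := by ring
      _ ≤ 2 * m * R * (2 * ((j + m) * X⁻¹)) := by gcongr
      _ = _ := by ring
  -- This is where `a r > 4 m R` enters: cells are small enough for the quasiconvexity hypothesis.
  have hsmall : 4 * m * R * ((j + m) * X⁻¹) < r := by
    have h1 : a * ((j + m) * X⁻¹) ≤ 1 := by
      rw [← mul_assoc, ← div_eq_mul_inv]
      exact (div_le_one hX0).2 hn
    have h2 : 0 < (j + m) * X⁻¹ := by positivity
    calc 4 * m * R * ((j + m) * X⁻¹) < a * r * ((j + m) * X⁻¹) := by gcongr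
      _ = r * (a * ((j + m) * X⁻¹)) := by ring
      _ ≤ r := mul_le_of_le_one_right hr.le h1
  refine nthEigenvalue_le_of_cells hUo (Metric.isBounded_ball.subset hUR) hT hp hV hUV hF hB
    (cubeIndex R q) (fun i => hUo.measurableSet.inter
      (measurable_cubeIndex R q (measurableSet_singleton i))) (by rw [hinv]; positivity)
    (fun y hy z hz hyz => ?_) ?_
  · have h1 := (dist_le_of_cubeIndex_eq (hUR hy) (hUR hz) hyz).trans hside
    obtain ⟨l, hl, hlC⟩ := hreach y hy z hz (h1.trans_lt hsmall)
    refine ⟨l, hl, ?_⟩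
    have hl0 := hl.nonneg
    rw [hinv]
    gcongr
    calc l ≤ C * dist y z := hlC
      _ ≤ C * (4 * m * R * ((j + m) * X⁻¹)) := by gcongr
      _ = _ := by ring
  · have h1 : ((q : ℝ) * j) ^ m ≤ n / 2 := by
      rw [← hXm]
      gcongr
      rw [le_div_iff₀ hjm] at hqle
      refine le_trans ?_ hqle
      gcongr
      linarith
    have h2 : (0 : ℝ) < n / 2 := hXm ▸ pow_pos hX0 m
    rw [Fintype.card_fun, Fintype.card_fin, Fintype.card_fin, ← mul_pow]
    have h3 : (((q * j) ^ m : ℕ) : ℝ) < n := by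
      push_cast
      linarith
    exact_mod_cast h3

/-! ### Full derivatives controlled by `M_j` -/

theorem norm_iteratedFDeriv_le_of_iteratedDeriv_line {E F : Type} [NormedAddCommGroup E]
    [NormedSpace ℝ E] [NormedAddCommGroup F] [NormedSpace ℝ F] {V : Set E} (hV : IsOpen V)
    {f : E → F} {k j : ℕ} (hf : ContDiffOn ℝ k f V) (hj1 : 1 ≤ j) (hj : j ≤ k) {y : E}
    (hy : y ∈ V) {D : ℝ} (hD0 : 0 ≤ D)
    (hD : ∀ v ∈ Metric.sphere (0 : E) 1,
      ‖iteratedDeriv j (fun s : ℝ => f (y + s • v)) 0‖ ≤ D) :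
    ‖iteratedFDeriv ℝ j f y‖ ≤ j ^ j / j.factorial * D := by
  set A := iteratedFDeriv ℝ j f y with hA
  have hdiag : ∀ v : E, ‖A fun _ => v‖ ≤ D * ‖v‖ ^ j := by
    intro v
    rcases eq_or_ne v 0 with rfl | hv
    · rw [A.map_coord_zero ⟨0, hj1⟩ rfl, norm_zero]
      positivity
    · have hv' : ‖v‖ ≠ 0 := norm_ne_zero_iff.2 hv
      have h1 : (fun _ : Fin j => v) = fun i : Fin j => ‖v‖ • (‖v‖⁻¹ • v) := by
        funext i
        rw [smul_smul, mul_inv_cancel₀ hv', one_smul]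
      have h2 := hD (‖v‖⁻¹ • v) (by simp [norm_smul, hv'])
      rw [iteratedDeriv_line hV hf hj hy] at h2
      rw [h1, A.map_smul_univ, norm_smul, Finset.prod_const, Finset.card_univ, Fintype.card_fin,
        norm_pow, norm_norm, mul_comm]
      gcongr
  have hsymm : ∀ (v : Fin j → E) (σ : Equiv.Perm (Fin j)), A (v ∘ σ) = A v := fun v σ =>
    iteratedFDeriv_comp_perm_of_contDiffAt
      ((hf.contDiffAt (hV.mem_nhds hy)).of_le (by exact_mod_cast hj)) v σ
  refine A.opNorm_le_bound (by positivity) fun v => ?_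
  by_cases hv : ∃ i, v i = 0
  · obtain ⟨i, hi⟩ := hv
    rw [A.map_coord_zero i hi, norm_zero]
    positivity
  · push Not at hv
    have hv' : ∀ i, ‖v i‖ ≠ 0 := fun i => norm_ne_zero_iff.2 (hv i)
    have h1 : v = fun i => ‖v i‖ • (‖v i‖⁻¹ • v i) := by
      funext i
      rw [smul_smul, mul_inv_cancel₀ (hv' i), one_smul]
    have h2 := norm_apply_le_of_symmetric A hsymm hD0 hdiag (v := fun i => ‖v i‖⁻¹ • v i)
      fun i => by simp [norm_smul, hv' i]
    have h3 : A v = (∏ i, ‖v i‖) • A fun i => ‖v i‖⁻¹ • v i := by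
      conv_lhs => rw [h1]
      exact A.map_smul_univ _ _
    rw [h3, norm_smul, Real.norm_of_nonneg (by positivity), mul_comm]
    gcongr
    rw [div_mul_eq_mul_div, le_div_iff₀ (by positivity), mul_comm]
    exact h2

theorem kernelDerivSup_nonneg {m : ℕ} (U : Set (EuclideanSpace ℝ (Fin m)))
    (F : EuclideanSpace ℝ (Fin m) → EuclideanSpace ℝ (Fin m) → ℂ) (j : ℕ) :
    0 ≤ kernelDerivSup U F j := by
  refine mul_nonneg (by positivity) (Real.sSup_nonneg ?_)
  rintro r ⟨x, -, y, -, v, -, rfl⟩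
  exact norm_nonneg _

/-- The bound `B` serves only to make the supremum in `kernelDerivSup` a genuine one; it does not
enter the estimate. -/
theorem norm_iteratedFDeriv_le_kernelDerivSup {m : ℕ} {U : Set (EuclideanSpace ℝ (Fin m))}
    (hU : IsOpen U) {F : EuclideanSpace ℝ (Fin m) → EuclideanSpace ℝ (Fin m) → ℂ} {k j : ℕ}
    (hF : ∀ x ∈ U, ContDiffOn ℝ k (F x) U) (hj1 : 1 ≤ j) (hj : j ≤ k) {B : ℝ}
    (hB : ∀ x ∈ U, ∀ y ∈ U, ‖iteratedFDeriv ℝ j (F x) y‖ ≤ B)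
    {x y : EuclideanSpace ℝ (Fin m)} (hx : x ∈ U) (hy : y ∈ U) :
    ‖iteratedFDeriv ℝ j (F x) y‖ ≤ j ^ j * kernelDerivSup U F j := by
  have hfac : (0 : ℝ) < j.factorial := by positivity
  have h := norm_iteratedFDeriv_le_of_iteratedDeriv_line hU (hF x hx) hj1 hj hy
    (D := j.factorial * kernelDerivSup U F j)
    (mul_nonneg hfac.le (kernelDerivSup_nonneg U F j)) fun v hv => ?_
  · refine h.trans_eq ?_
    field_simp
  · rw [kernelDerivSup, ← mul_assoc, mul_one_div_cancel hfac.ne', one_mul]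
    refine le_csSup ⟨B, ?_⟩ ⟨x, hx, y, hy, v, hv, rfl⟩
    rintro r ⟨x', hx', y', hy', w, hw, rfl⟩
    rw [iteratedDeriv_line hU (hF x' hx') hj hy']
    refine (ContinuousMultilinearMap.le_opNorm _ _).trans ?_
    have hw' : ‖w‖ = 1 := by simpa using hw
    simpa [hw'] using hB x' hx' y' hy'

/-! ### Connected components and vanishing derivatives -/

theorem PolygonalReach.of_path {E : Type} [NormedAddCommGroup E] [NormedSpace ℝ E] {V : Set E}
    {p : ℕ → E} {N : ℕ} (h : ∀ i < N, segment ℝ (p i) (p (i + 1)) ⊆ V) :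
    PolygonalReach V (p 0) (p N) (∑ i ∈ Finset.range N, dist (p i) (p (i + 1))) := by
  induction N with
  | zero => exact .refl
  | succ N ih =>
    rw [Finset.sum_range_succ]
    exact (ih fun i hi => h i (by omega)).step (h N (by omega))

/-- Balls are convex, so the set of points reachable from `y` is open and closed in `U`. -/
theorem exists_polygonalReach_of_connectedComponent_eq {E : Type} [NormedAddCommGroup E]
    [NormedSpace ℝ E] {U : Set E} (hU : IsOpen U) {y z : U}
    (h : (y : ConnectedComponents U) = z) : ∃ l, PolygonalReach U (y : E) z l := by
  set S : Set U := {w | ∃ l, PolygonalReach U (y : E) w l} with hS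
  have hloc : ∀ w : U, ∃ ε > 0, ∀ w' : U, dist w' w < ε → (w' ∈ S ↔ w ∈ S) := by
    intro w
    obtain ⟨ε, hε, hb⟩ := Metric.isOpen_iff.1 hU w w.2
    refine ⟨ε, hε, fun w' hw' => ?_⟩
    have h1 : (w : E) ∈ Metric.ball (w : E) ε := Metric.mem_ball_self hε
    have h2 : (w' : E) ∈ Metric.ball (w : E) ε := hw'
    have hc := convex_ball (w : E) ε
    exact ⟨fun ⟨l, hl⟩ => ⟨_, hl.step ((hc.segment_subset h2 h1).trans hb)⟩,
      fun ⟨l, hl⟩ => ⟨_, hl.step ((hc.segment_subset h1 h2).trans hb)⟩⟩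
  have hclopen : IsClopen S := by
    constructor
    · rw [← isOpen_compl_iff, Metric.isOpen_iff]
      intro w hw
      obtain ⟨ε, hε, h⟩ := hloc w
      exact ⟨ε, hε, fun w' hw' h' => hw ((h w' hw').1 h')⟩
    · rw [Metric.isOpen_iff]
      intro w hw
      obtain ⟨ε, hε, h⟩ := hloc w
      exact ⟨ε, hε, fun w' hw' => (h w' hw').2 hw⟩
  have hyS : y ∈ S := ⟨0, .refl⟩
  have hz : z ∈ connectedComponent y := by
    rw [ConnectedComponents.coe_eq_coe.1 h]
    exact mem_connectedComponent
  exact hclopen.connectedComponent_subset hyS hz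

/-- The cells are now the components. With derivative bound `0` the Taylor error vanishes for a path
of any length. The extra value `none` labels the points outside `U`. -/
theorem nthEigenvalue_nonpos_of_finite_components {m : ℕ}
    {U : Set (EuclideanSpace ℝ (Fin m))} (hUo : IsOpen U) (hUb : Bornology.IsBounded U)
    [Finite (ConnectedComponents U)]
    {F : EuclideanSpace ℝ (Fin m) → EuclideanSpace ℝ (Fin m) → ℂ}
    {T : L2 U →L[ℂ] L2 U} (hT : IsIntegralOperator U F T) (hp : T.IsPositive) {j : ℕ}
    (hF : ∀ x ∈ U, ContDiffOn ℝ j (F x) U)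
    (hB : ∀ x ∈ U, ∀ y ∈ U, ‖iteratedFDeriv ℝ j (F x) y‖ ≤ 0) {n : ℕ}
    (hn : Nat.card (Option (ConnectedComponents U)) * j ^ m < n) : nthEigenvalue T n ≤ 0 := by
  classical
  have := Fintype.ofFinite (ConnectedComponents U)
  let π : EuclideanSpace ℝ (Fin m) → Option (ConnectedComponents U) := fun y =>
    if h : y ∈ U then some (ConnectedComponents.mk ⟨y, h⟩) else none
  have hπ : ∀ {y} (h : y ∈ U), π y = some (ConnectedComponents.mk ⟨y, h⟩) := fun h => dif_pos h
  rw [Nat.card_eq_fintype_card] at hn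
  refine (nthEigenvalue_le_of_cells hUo hUb hT hp hUo subset_rfl hF hB π (fun i => ?_) le_rfl
    (fun y hy z hz hyz => ?_) hn).trans_eq (zero_mul _)
  · have : LocallyConnectedSpace U := hUo.locallyConnectedSpace
    cases i with
    | none =>
      convert MeasurableSet.empty using 1
      ext y
      simp only [mem_ofPred_eq, mem_empty_iff_false, iff_false, not_and]
      intro hy
      rw [hπ hy]
      simp
    | some κ =>
      obtain ⟨x, rfl⟩ := ConnectedComponents.surjective_coe κ
      have h1 : {y | y ∈ U ∧ π y = some (x : ConnectedComponents U)} =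
          Subtype.val '' connectedComponent x := by
        ext y
        constructor
        · rintro ⟨hy, h⟩
          rw [hπ hy, Option.some_inj] at h
          exact ⟨⟨y, hy⟩, ConnectedComponents.coe_eq_coe'.1 h, rfl⟩
        · rintro ⟨w, hw, rfl⟩
          exact ⟨w.2, by rw [hπ w.2, Option.some_inj]; exact ConnectedComponents.coe_eq_coe'.2 hw⟩
      rw [h1]
      exact (hUo.isOpenMap_subtype_val _ isOpen_connectedComponent).measurableSet
  · rw [hπ hy, hπ hz, Option.some_inj] at hyz
    obtain ⟨l, hl⟩ := exists_polygonalReach_of_connectedComponent_eq hUo hyz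
    exact ⟨l, hl, by simp⟩

/-! ### From cell estimates to the stated bounds -/

theorem eigenvaluePowerDecay_of_eventual_bound {m : ℕ} (hm : 1 ≤ m)
    {U : Set (EuclideanSpace ℝ (Fin m))} {T : L2 U →L[ℂ] L2 U} (hp : T.IsPositive) {k : ℕ}
    {a D : ℝ} (ha : 0 ≤ a) (hD : 0 ≤ D)
    (h : ∀ n : ℕ, 1 ≤ n → a * ((k : ℝ) + m) ≤ ((n : ℝ) / 2) ^ ((1 : ℝ) / m) →
      nthEigenvalue T n ≤ D * ((2 / (n : ℝ)) ^ ((1 : ℝ) / m)) ^ k) :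
    EigenvaluePowerDecay U T k := by
  set n₀ : ℝ := 2 * (a * (k + m)) ^ m with hn₀
  have hn₀0 : 0 ≤ n₀ := by positivity
  have hm0 : (0 : ℝ) < m := by exact_mod_cast hm
  refine ⟨D * 2 ^ ((k : ℝ) / m) + ‖T‖ * n₀ ^ ((k : ℝ) / m) + 1, by positivity, fun n hn => ?_⟩
  have hn0 : (0 : ℝ) < n := by exact_mod_cast hn
  have hpow : (0 : ℝ) < (n : ℝ) ^ (-((k : ℝ) / m)) := Real.rpow_pos_of_pos hn0 _
  rcases le_or_gt (a * ((k : ℝ) + m)) (((n : ℝ) / 2) ^ ((1 : ℝ) / m)) with hc | hc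
  · have h1 : ((2 / (n : ℝ)) ^ ((1 : ℝ) / m)) ^ k =
        2 ^ ((k : ℝ) / m) * (n : ℝ) ^ (-((k : ℝ) / m)) := by
      rw [← Real.rpow_mul_natCast (by positivity), one_div_mul_eq_div, Real.div_rpow (by norm_num)
        hn0.le, Real.rpow_neg hn0.le, div_eq_mul_inv]
    refine (h n hn hc).trans ?_
    rw [h1, ← mul_assoc]
    gcongr
    have : 0 ≤ ‖T‖ * n₀ ^ ((k : ℝ) / m) := by positivity
    linarith
  -- Only finitely many `n` remain; for them `λ_n(T) ≤ ‖T‖` suffices.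
  · have h1 : (n : ℝ) ≤ n₀ := by
      have h2 : (((n : ℝ) / 2) ^ ((1 : ℝ) / m)) ^ m ≤ (a * (k + m)) ^ m := by gcongr
      rw [one_div, Real.rpow_inv_natCast_pow (by positivity) (by omega)] at h2
      linarith
    have h2 : 1 ≤ n₀ ^ ((k : ℝ) / m) * (n : ℝ) ^ (-((k : ℝ) / m)) := by
      rw [Real.rpow_neg hn0.le, ← div_eq_mul_inv, ← Real.div_rpow hn₀0 hn0.le]
      exact Real.one_le_rpow ((one_le_div hn0).2 h1) (by positivity)
    calc nthEigenvalue T n ≤ ‖T‖ := nthEigenvalue_le_norm hp.isSymmetric hn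
      _ ≤ ‖T‖ * (n₀ ^ ((k : ℝ) / m) * (n : ℝ) ^ (-((k : ℝ) / m))) :=
        le_mul_of_one_le_right (norm_nonneg _) h2
      _ = ‖T‖ * n₀ ^ ((k : ℝ) / m) * (n : ℝ) ^ (-((k : ℝ) / m)) := by ring
      _ ≤ _ := by
        gcongr
        have : 0 ≤ D * (2 : ℝ) ^ ((k : ℝ) / m) := by positivity
        linarith

/-- The cell argument yields the power `(j + m)^j`; since `j + m ≥ 1`, it may be raised to `(j +
m)^(j + m)`. -/
theorem scaled_bound_mono {m j : ℕ} (hm : 1 ≤ m) {D A M a b ρ : ℝ} (hD0 : 0 ≤ D) (hb : 0 ≤ b)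
    (hρ : 0 ≤ ρ) (hD : D ≤ A * M) (hba : b ≤ a) :
    D * (b * ((j : ℝ) + m) * ρ) ^ j ≤ A * (M * (a * ρ) ^ j * ((j : ℝ) + m) ^ (j + m)) := by
  have hjm : (1 : ℝ) ≤ (j : ℝ) + m := by
    have : (1 : ℝ) ≤ m := by exact_mod_cast hm
    have : (0 : ℝ) ≤ j := by positivity
    linarith
  have ha : 0 ≤ a := hb.trans hba
  have hAM : 0 ≤ A * M := hD0.trans hD
  calc D * (b * ((j : ℝ) + m) * ρ) ^ j ≤ A * M * (a * ((j : ℝ) + m) * ρ) ^ j := by gcongr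
    _ = A * M * (a * ρ) ^ j * ((j : ℝ) + m) ^ j := by rw [mul_pow, mul_pow, mul_pow]; ring
    _ ≤ A * M * (a * ρ) ^ j * ((j : ℝ) + m) ^ (j + m) := by
      gcongr
      omega
    _ = _ := by ring

theorem self_pow_div_factorial_le (j : ℕ) : (j : ℝ) ^ j / j.factorial ≤ Real.exp 1 ^ j := by
  rw [← Real.exp_nat_mul, mul_one]
  exact Real.pow_div_factorial_le_exp _ (Nat.cast_nonneg j) j

theorem IsLocallyQuasiconvex.exists_polygonalReach {m : ℕ} {U : Set (EuclideanSpace ℝ (Fin m))}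
    (h : IsLocallyQuasiconvex U) : ∃ r : ℝ, 0 < r ∧ ∃ C : ℝ, 0 ≤ C ∧
      ∀ y ∈ U, ∀ z ∈ U, dist y z < r → ∃ l, PolygonalReach U y z l ∧ l ≤ C * dist y z := by
  obtain ⟨r, hr, C, hC⟩ := h
  refine ⟨r, hr, max C 0, le_max_right _ _, fun y hy z hz hyz => ?_⟩
  obtain ⟨N, p, rfl, rfl, hp, hl⟩ := hC y hy z hz hyz
  refine ⟨_, .of_path hp, hl.trans ?_⟩
  gcongr
  exact le_max_left _ _

theorem IsCkUpToClosure.exists_bound {m k : ℕ} {U : Set (EuclideanSpace ℝ (Fin m))}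
    (hUo : IsOpen U) (hUb : Bornology.IsBounded U)
    {F : EuclideanSpace ℝ (Fin m) → EuclideanSpace ℝ (Fin m) → ℂ} (hF : IsCkUpToClosure k U F)
    {j : ℕ} (hj : j ≤ k) :
    ∃ B : ℝ, ∀ x ∈ U, ∀ y ∈ U, ‖iteratedFDeriv ℝ j (F x) y‖ ≤ B := by
  obtain ⟨G, hGc, hG⟩ := hF.2 j hj
  obtain ⟨B, hB⟩ := (hUb.isCompact_closure.prod hUb.isCompact_closure).exists_bound_of_continuousOn
    hGc
  refine ⟨B, fun x hx y hy => ?_⟩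
  refine (norm_iteratedFDeriv_slice_le (hUo.prod hUo) hF.1 hj ⟨hx, hy⟩).trans ?_
  rw [hG ⟨hx, hy⟩]
  exact hB _ ⟨subset_closure hx, subset_closure hy⟩

theorem exists_eigenvalueBound_of_isLocallyQuasiconvex {m : ℕ} (hm : 1 ≤ m)
    {U : Set (EuclideanSpace ℝ (Fin m))} (hUo : IsOpen U) (hUb : Bornology.IsBounded U)
    (hU : IsLocallyQuasiconvex U) :
    ∃ A : ℝ, 0 < A ∧ ∃ a : ℝ, 0 < a ∧
      ∀ (k : ℕ) (F : EuclideanSpace ℝ (Fin m) → EuclideanSpace ℝ (Fin m) → ℂ)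
        (T : L2 U →L[ℂ] L2 U), IsCkUpToClosure k U F → IsIntegralOperator U F T → T.IsPositive →
        EigenvalueBound U F T k A a := by
  obtain ⟨r, hr, C, hC, hreach⟩ := hU.exists_polygonalReach
  obtain ⟨R, hR, hUR⟩ := hUb.subset_ball_lt 0 0
  have hvol : 0 ≤ volume.real U := measureReal_nonneg
  have he : 0 < Real.exp 1 := Real.exp_pos 1
  set b : ℝ := Real.exp 1 * (4 * C * m * R) with hb
  have hb0 : 0 ≤ b := by positivity
  have hr0 : 0 ≤ 4 * m * R / r := by positivity
  -- The summands of `a` ensure in turn `a ≥ 1`, `a ≥ b` and, together, `a r > 4 m R`. The `1` in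
  -- `A` makes it positive.
  refine ⟨volume.real U + 1, by positivity, 1 + b + 4 * m * R / r, by positivity,
    fun k F T hF hT hp n hn j hj => ?_⟩
  obtain ⟨hj1, hjk, hjn⟩ := hj
  have hslice : ∀ x ∈ U, ContDiffOn ℝ k (F x) U := fun x hx =>
    contDiffOn_slice hF.1 fun y hy => ⟨hx, hy⟩
  obtain ⟨B, hB⟩ := hF.exists_bound hUo hUb hjk
  set M := kernelDerivSup U F j with hM
  have hM0 : 0 ≤ M := kernelDerivSup_nonneg U F j
  set ρ : ℝ := (2 / (n : ℝ)) ^ ((1 : ℝ) / m) with hρ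
  have hρ0 : 0 ≤ ρ := by positivity
  have h := nthEigenvalue_le_of_quasiconvex hm hUo hR hUR hUo subset_rfl hr hreach hT hp
    (fun x hx => (hslice x hx).of_le (by exact_mod_cast hjk)) (B := j ^ j * M) (by positivity)
    (fun x hx y hy => norm_iteratedFDeriv_le_kernelDerivSup hUo hslice hj1 hjk hB hx hy) hC
    (by linarith) (by
      rw [add_mul, div_mul_cancel₀ _ hr.ne']
      have : 0 < (1 + b) * r := by positivity
      linarith) hjn
  refine h.trans ?_
  have h1 : (j : ℝ) ^ j * M * (4 * C * m * R * (j + m) * ρ) ^ j / j.factorial * volume.real U ≤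
      volume.real U * M * (b * ((j : ℝ) + m) * ρ) ^ j := by
    calc (j : ℝ) ^ j * M * (4 * C * m * R * (j + m) * ρ) ^ j / j.factorial * volume.real U
        = (j : ℝ) ^ j / j.factorial *
          (volume.real U * M * (4 * C * m * R * (j + m) * ρ) ^ j) := by ring
      _ ≤ Real.exp 1 ^ j * (volume.real U * M * (4 * C * m * R * (j + m) * ρ) ^ j) := by
        gcongr
        exact self_pow_div_factorial_le j
      _ = _ := by rw [hb, mul_assoc (Real.exp 1), mul_assoc (Real.exp 1), mul_pow (Real.exp 1)]; ring
  refine h1.trans (scaled_bound_mono hm (by positivity) hb0 hρ0 ?_ (by linarith))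
  gcongr
  linarith

/-- A compact neighbourhood of the product of closures still lies in the domain of smoothness. This
leaves room for segments that exit `U`. -/
theorem IsCkNearClosure.exists_bound {m k : ℕ} {U : Set (EuclideanSpace ℝ (Fin m))}
    (hUb : Bornology.IsBounded U)
    {F : EuclideanSpace ℝ (Fin m) → EuclideanSpace ℝ (Fin m) → ℂ} (hF : IsCkNearClosure k U F) :
    ∃ δ > 0, (∀ x ∈ U, ContDiffOn ℝ k (F x) (Metric.thickening δ (closure U))) ∧
      ∀ j ≤ k, ∃ B : ℝ, 0 ≤ B ∧ ∀ x ∈ U, ∀ y ∈ Metric.thickening δ (closure U),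
        ‖iteratedFDeriv ℝ j (F x) y‖ ≤ B := by
  obtain ⟨W, hW, hKW, hFW⟩ := hF
  have hK := hUb.isCompact_closure
  obtain ⟨δ, hδ, hδW⟩ := (hK.prod hK).exists_cthickening_subset_open hW hKW
  have hmem : ∀ x ∈ U, ∀ y ∈ Metric.thickening δ (closure U),
      (x, y) ∈ Metric.cthickening δ (closure U ×ˢ closure U) := by
    intro x hx y hy
    obtain ⟨z, hz, hyz⟩ := Metric.mem_thickening_iff.1 hy
    refine Metric.thickening_subset_cthickening _ _ (Metric.mem_thickening_iff.2
      ⟨(x, z), ⟨subset_closure hx, hz⟩, ?_⟩)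
    rw [Prod.dist_eq]
    simpa [hδ] using hyz
  refine ⟨δ, hδ, fun x hx => contDiffOn_slice hFW fun y hy => hδW (hmem x hx y hy),
    fun j hj => ?_⟩
  have hcont : ContinuousOn (iteratedFDeriv ℝ j (Function.uncurry F)) W :=
    (hFW.continuousOn_iteratedFDerivWithin (by exact_mod_cast hj) hW.uniqueDiffOn).congr
      fun z hz => (iteratedFDerivWithin_of_isOpen j hW hz).symm
  obtain ⟨B, hB⟩ := (hK.prod hK).cthickening (r := δ) |>.exists_bound_of_continuousOn
    (hcont.mono hδW)
  refine ⟨max B 0, le_max_right _ _, fun x hx y hy => ?_⟩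
  exact (norm_iteratedFDeriv_slice_le hW hFW hj (hδW (hmem x hx y hy))).trans
    ((hB _ (hmem x hx y hy)).trans (le_max_left _ _))

theorem exists_polygonalReach_thickening {E : Type} [NormedAddCommGroup E] [NormedSpace ℝ E]
    {K : Set E} {δ : ℝ} (hδ : 0 < δ) {y z : E} (hy : y ∈ K) (h : dist y z < δ) :
    ∃ l, PolygonalReach (Metric.thickening δ K) y z l ∧ l ≤ 1 * dist y z := by
  refine ⟨0 + dist y z, PolygonalReach.refl.step ?_, by simp⟩
  have h1 := (convex_ball y δ).segment_subset (Metric.mem_ball_self hδ)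
    (show z ∈ Metric.ball y δ by rwa [Metric.mem_ball, dist_comm])
  exact h1.trans (Metric.ball_subset_thickening hy δ)

theorem eigenvalue_estimates_of_isCkNearClosure {m : ℕ} (hm : 1 ≤ m)
    {U : Set (EuclideanSpace ℝ (Fin m))} (hUo : IsOpen U) (hUb : Bornology.IsBounded U) {k : ℕ}
    {F : EuclideanSpace ℝ (Fin m) → EuclideanSpace ℝ (Fin m) → ℂ} {T : L2 U →L[ℂ] L2 U}
    (hF : IsCkNearClosure k U F) (hT : IsIntegralOperator U F T) (hp : T.IsPositive) :
    ((Finite (ConnectedComponents U) ∨ ∀ j : ℕ, 1 ≤ j → j ≤ k → 0 < kernelDerivSup U F j) →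
      ∃ A : ℝ, 0 < A ∧ ∃ a : ℝ, 0 < a ∧ EigenvalueBound U F T k A a) ∧
    EigenvaluePowerDecay U T k := by
  obtain ⟨δ, hδ, hslice, hbd⟩ := hF.exists_bound hUb
  choose! B hB0 hB using hbd
  obtain ⟨R, hR, hUR⟩ := hUb.subset_ball_lt 0 0
  have hUV : U ⊆ Metric.thickening δ (closure U) :=
    subset_closure.trans (Metric.self_subset_thickening hδ _)
  have hvol : 0 ≤ volume.real U := measureReal_nonneg
  set b : ℝ := 4 * 1 * m * R with hb
  have hb0 : 0 ≤ b := by positivity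
  have hr0 : 0 ≤ 4 * m * R / δ := by positivity
  -- Used only for finitely many components; otherwise `Nat.card` is `0` and `c` is harmless.
  set c : ℝ := (Nat.card (Option (ConnectedComponents U)) : ℝ) with hc
  have hc0 : 0 ≤ c := by positivity
  set a : ℝ := 1 + b + 4 * m * R / δ + c with ha
  have haδ : 4 * m * R < a * δ := by
    rw [ha, add_right_comm, add_mul, div_mul_cancel₀ _ hδ.ne']
    have : 0 < (1 + b + c) * δ := by positivity
    linarith
  have hmain : ∀ j ≤ k, ∀ n : ℕ, a * ((j : ℝ) + m) ≤ ((n : ℝ) / 2) ^ ((1 : ℝ) / m) →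
      nthEigenvalue T n ≤ B j / j.factorial * volume.real U *
        (b * ((j : ℝ) + m) * (2 / (n : ℝ)) ^ ((1 : ℝ) / m)) ^ j := by
    intro j hj n hn
    have h := nthEigenvalue_le_of_quasiconvex hm hUo hR hUR Metric.isOpen_thickening hUV hδ
      (fun y hy z _ h => exists_polygonalReach_thickening hδ (subset_closure hy) h) hT hp
      (fun x hx => (hslice x hx).of_le (by exact_mod_cast hj)) (hB0 j hj) (hB j hj) zero_le_one
      (by linarith) haδ hn
    refine h.trans_eq ?_
    rw [hb]
    ring
  constructor
  · intro hcase
    -- A sum in place of a maximum; terms with `kernelDerivSup U F j = 0` are `0` by the convention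
    -- for division.
    set A : ℝ := ∑ j ∈ Finset.range (k + 1),
      B j / j.factorial * volume.real U / kernelDerivSup U F j with hA
    have hterm : ∀ j ∈ Finset.range (k + 1),
        0 ≤ B j / j.factorial * volume.real U / kernelDerivSup U F j := fun j hj =>
      div_nonneg (mul_nonneg (div_nonneg (hB0 j (Nat.lt_succ_iff.1 (Finset.mem_range.1 hj)))
        (by positivity)) hvol) (kernelDerivSup_nonneg U F j)
    have hA0 : 0 ≤ A := Finset.sum_nonneg hterm
    refine ⟨A + 1, by positivity, a, by positivity, fun n hn j hj => ?_⟩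
    obtain ⟨hj1, hjk, hjn⟩ := hj
    have hBj := hB0 j hjk
    rcases (kernelDerivSup_nonneg U F j).eq_or_lt with hM | hM
    · rcases hcase with hfin | hpos
      swap
      · exact absurd (hpos j hj1 hjk) hM.not_lt
      rw [← hM, zero_mul, zero_mul, mul_zero]
      have hsliceU : ∀ x ∈ U, ContDiffOn ℝ k (F x) U := fun x hx => (hslice x hx).mono hUV
      refine nthEigenvalue_nonpos_of_finite_components hUo hUb hT hp (j := j)
        (fun x hx => (hsliceU x hx).of_le (by exact_mod_cast hjk)) (fun x hx y hy => ?_) ?_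
      · have h := norm_iteratedFDeriv_le_kernelDerivSup hUo hsliceU hj1 hjk
          (fun x hx y hy => hB j hjk x hx y (hUV hy)) hx hy
        rwa [← hM, mul_zero] at h
      · have hj0 : (0 : ℝ) < j := by exact_mod_cast hj1
        have h1 : (a * ((j : ℝ) + m)) ^ m ≤ n / 2 := by
          rw [← Real.rpow_inv_natCast_pow (n := m) (x := (n : ℝ) / 2) (by positivity) (by omega),
            ← one_div]
          gcongr
        -- Including `c` in `a` makes `c j^m ≤ n/2 < n` for admissible `j`, the count needed for
        -- `λ_n(T) ≤ 0`.
        have hca : c ≤ a ^ m := (show c ≤ a by linarith).trans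
          (le_self_pow₀ (by linarith) (by omega))
        have h2 : c * (j : ℝ) ^ m ≤ (a * ((j : ℝ) + m)) ^ m := by
          rw [mul_pow]
          gcongr
          linarith [show (0 : ℝ) ≤ m by positivity]
        have hn0 : (0 : ℝ) < n := by exact_mod_cast hn
        have h3 : ((Nat.card (Option (ConnectedComponents U)) * j ^ m : ℕ) : ℝ) < n := by
          push_cast
          rw [← hc]
          linarith
        exact_mod_cast h3
    · refine (hmain j hjk n hjn).trans (scaled_bound_mono hm (by positivity) hb0 (by positivity)
        ?_ (by linarith))
      rw [← div_le_iff₀ hM]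
      have := Finset.single_le_sum hterm (Finset.mem_range.2 (Nat.lt_succ_iff.2 hjk))
      linarith
  · have hBk := hB0 k le_rfl
    refine eigenvaluePowerDecay_of_eventual_bound hm hp (a := a)
      (D := B k / k.factorial * volume.real U * (b * (k + m)) ^ k) (by positivity) (by positivity)
      fun n _ hn => (hmain k le_rfl n hn).trans_eq ?_
    rw [mul_pow (b * _)]
    ring

theorem EigenvalueBound.eigenvaluePowerDecay {m : ℕ} (hm : 1 ≤ m)
    {U : Set (EuclideanSpace ℝ (Fin m))}
    {F : EuclideanSpace ℝ (Fin m) → EuclideanSpace ℝ (Fin m) → ℂ} {T : L2 U →L[ℂ] L2 U}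
    (hp : T.IsPositive) {k : ℕ} (hk : 1 ≤ k) {A a : ℝ} (hA : 0 ≤ A) (ha : 0 ≤ a)
    (h : EigenvalueBound U F T k A a) : EigenvaluePowerDecay U T k := by
  have hM := kernelDerivSup_nonneg U F k
  refine eigenvaluePowerDecay_of_eventual_bound hm hp (a := a)
    (D := A * (kernelDerivSup U F k * a ^ k * ((k : ℝ) + m) ^ (k + m))) ha (by positivity)
    fun n hn hkn => (h n hn k ⟨hk, le_rfl, hkn⟩).trans_eq ?_
  rw [mul_pow]
  ring

theorem mainTheorem4 (m : ℕ) (hm : 1 ≤ m) (U : Set (EuclideanSpace ℝ (Fin m)))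
    (hUo : IsOpen U) (hUb : Bornology.IsBounded U) :
    -- constants for a given kernel, arbitrary bounded open `U`
    (∀ (k : ℕ) (F : EuclideanSpace ℝ (Fin m) → EuclideanSpace ℝ (Fin m) → ℂ)
        (T : L2 U →L[ℂ] L2 U), 1 ≤ k → IsCkNearClosure k U F → IsHermitianKernel U F →
        IsIntegralOperator U F T → T.IsPositive →
      ((Finite (ConnectedComponents U) ∨ ∀ j : ℕ, 1 ≤ j → j ≤ k → 0 < kernelDerivSup U F j) →
        ∃ A : ℝ, 0 < A ∧ ∃ a : ℝ, 0 < a ∧ EigenvalueBound U F T k A a) ∧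
      EigenvaluePowerDecay U T k) ∧
    -- constants that depend only on `U`, for locally quasiconvex `U`
    (IsLocallyQuasiconvex U →
      (∃ A : ℝ, 0 < A ∧ ∃ a : ℝ, 0 < a ∧
        ∀ (k : ℕ) (F : EuclideanSpace ℝ (Fin m) → EuclideanSpace ℝ (Fin m) → ℂ)
          (T : L2 U →L[ℂ] L2 U), 1 ≤ k → IsCkUpToClosure k U F → IsHermitianKernel U F →
          IsIntegralOperator U F T → T.IsPositive →
          EigenvalueBound U F T k A a) ∧
      (∀ (k : ℕ) (F : EuclideanSpace ℝ (Fin m) → EuclideanSpace ℝ (Fin m) → ℂ)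
          (T : L2 U →L[ℂ] L2 U), 1 ≤ k → IsCkUpToClosure k U F → IsHermitianKernel U F →
          IsIntegralOperator U F T → T.IsPositive →
          EigenvaluePowerDecay U T k)) := by
  refine ⟨fun k F T _ hF _ hT hp => eigenvalue_estimates_of_isCkNearClosure hm hUo hUb hF hT hp,
    fun hU => ?_⟩
  obtain ⟨A, hA, a, ha, h⟩ := exists_eigenvalueBound_of_isLocallyQuasiconvex hm hUo hUb hU
  exact ⟨⟨A, hA, a, ha, fun k F T _ hF _ hT hp => h k F T hF hT hp⟩,
    fun k F T hk hF _ hT hp => (h k F T hF hT hp).eigenvaluePowerDecay hm hp hk hA.le ha.le⟩
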